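/- **Conventions.** Manifolds are Hausdorff spaces with a smooth atlas (smooth in the sense of Michal--Bastiani) whose charts take values in Hausdorff locally convex real vector spaces, where the model space may vary from chart to chart. A subset $N$ of a manifold is a *submanifold* if around each of its points there is a chart of the manifold mapping $N$ onto the part of the chart image lying in a closed linear subspace of the model space; it then carries the induced manifold structure. A *smooth submersion* is a smooth map that in suitable charts around each point is the projection onto a factor of a topological direct sum. Let $G$ be a Lie group and $M$ a $G$-manifold, i.e. $G\times M\to M$ is a smooth action. A Lie subgroup $H\subseteq G$ (a subgroup that is a submanifold) is *principal* if $G/H$ carries a manifold structure for which $G\to G/H$ is a smooth principal $H$-bundle. The action is *proper* if preimages of compact sets under $G\times M\to M\times M$, $(g,m)\mapsto(g\cdot m,m)$, are compact. Let $G_m$ be the stabilizer of $m$ and $(H)$ the conjugacy class of a subgroup $H$; write $(H)\le(K)$ if $H$ is conjugate to a subgroup of $K$, and put $$M_{(H)}=\{m\in M: (G_m)=(H)\},\qquad M_{\ge(H)}=\{m\in M:(H)\le(G_m)\}.$$ A *slice* at $m$ is a submanifold $S\subseteq M$ containing $m$ such that (1) $G_m\cdot S\subseteq S$; (2) $g\cdot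 S\cap S\ne\emptyset$ implies $g\in G_m$; (3) $G_m$ is a principal Lie subgroup and $G\to G/G_m$ has a smooth local section $\chi$ on an open neighborhood $U$ of the identity coset such that $U\times S\to M$, $(q,s)\mapsto\chi(q)\cdot s$, is a diffeomorphism onto an open neighborhood of $m$; (4) $S\cap M_{(G_m)}$ is a closed submanifold of $S$. A *stratification* of a Hausdorff space $X$ is a partition of $X$ into locally closed subsets $X_\sigma$, each endowed with a manifold structure inducing the relative topology, such that for any two disjoint strata with $X_\varsigma\cap\overline{X_\sigma}\ne\emptyset$ one has $X_\varsigma\subseteq\overline{X_\sigma}\setminus X_\sigma$ and $X_\sigma\cap\overline{X_\varsigma}=\emptyset$. **Theorem (Orbit Type Stratification of the Orbit Space).** Let $M$ be a $G$-manifold with proper $G$-action admitting a slice at every point, and assume that the topology of $M\times M$ is compactly generated (for instance, that $M$ is first countable, as is every Fréchet manifold). Assume that the approximation property $M_{\ge(H)}\subseteq\overline{M_{(H)}}$ holds for every stabilizer subgroup $H\subseteq G$. Then the orbit space $M/G$ with the quotient topology is Hausdorff, and its partition into the sets $M_{(H)}/G$, indexed by the orbit types $(H)$ of the action, is a stratification.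 Moreover, every $M_{(H)}$ is a submanifold of $M$, and the manifold structure on the stratum $M_{(H)}/G$ is the unique one for which the canonical projection $M_{(H)}\to M_{(H)}/G$ is a smooth submersion. -/

import Mathlib

open Set Filter Topology

universe u v w

/-! ### Differential calculus on locally convex spaces -/

/-- Hausdorff locally convex real topological vector spaces. -/
class LCSpace (E : Type*) [AddCommGroup E] [Module ℝ E] [TopologicalSpace E] : Prop extends
  IsTopologicalAddGroup E, ContinuousSMul ℝ E, LocallyConvexSpace ℝ E, T2Space E

instance LCSpace.instProd {E F : Type*} [AddCommGroup E] [Module ℝ E] [TopologicalSpace E]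
    [LCSpace E] [AddCommGroup F] [Module ℝ F] [TopologicalSpace F] [LCSpace F] :
    LCSpace (E × F) where

instance LCSpace.instSubmodule {E : Type*} [AddCommGroup E] [Module ℝ E] [TopologicalSpace E]
    [LCSpace E] (F : Submodule ℝ E) : LCSpace F where

/-- `CnOn n f U`: the map `f` is of class `C^n` on the open set `U` in the sense of Michal and
Bastiani. Class `C^0` is continuity; class `C^(n+1)` means that `f` is continuous, that all
directional derivatives `df (x, v) = lim_{t → 0} (f (x + t v) - f x) / t` with `x ∈ U` exist, and
that `df` is of class `C^n` on `U × E`. -/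
def CnOn {F : Type w} [AddCommGroup F] [Module ℝ F] [TopologicalSpace F] : (n : ℕ) →
    {E : Type v} → [AddCommGroup E] → [Module ℝ E] → [TopologicalSpace E] →
    (f : E → F) → (U : Set E) → Prop
  | 0, _, _, _, _, f, U => ContinuousOn f U
  | n + 1, E, _, _, _, f, U => ContinuousOn f U ∧ ∃ df : E × E → F,
      (∀ x ∈ U, ∀ v, Tendsto (fun t : ℝ => t⁻¹ • (f (x + t • v) - f x)) (𝓝[≠] 0)
        (𝓝 (df (x, v)))) ∧
      CnOn n df (U ×ˢ univ)

/-- Smooth maps on an open subset of a locally convex space. -/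
def SmoothlyOn {E : Type v} {F : Type w} [AddCommGroup E] [Module ℝ E] [TopologicalSpace E]
    [AddCommGroup F] [Module ℝ F] [TopologicalSpace F] (f : E → F) (U : Set E) : Prop :=
  ∀ n : ℕ, CnOn n f U

section Calculus

variable {E : Type v} {F : Type w} {K : Type u} [AddCommGroup E] [Module ℝ E] [TopologicalSpace E]
  [AddCommGroup F] [Module ℝ F] [TopologicalSpace F]
  [AddCommGroup K] [Module ℝ K] [TopologicalSpace K]

theorem CnOn.continuousOn {n : ℕ} {f : E → F} {U : Set E} (h : CnOn n f U) :
    ContinuousOn f U := by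
  cases n with
  | zero => exact h
  | succ n => exact h.1

theorem CnOn.mono {n : ℕ} : ∀ {E : Type v} [AddCommGroup E] [Module ℝ E] [TopologicalSpace E]
    {f : E → F} {U V : Set E}, CnOn n f U → V ⊆ U → CnOn n f V := by
  induction n with
  | zero => intro E _ _ _ f U V h hV; exact ContinuousOn.mono h hV
  | succ n ih =>
    intro E _ _ _ f U V h hV
    obtain ⟨hc, df, hdf, hn⟩ := h
    exact ⟨hc.mono hV, df, fun x hx v => hdf x (hV hx) v, ih hn (prod_mono hV subset_rfl)⟩

theorem tendsto_line [LCSpace E] (x v : E) :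
    Tendsto (fun t : ℝ => x + t • v) (𝓝[≠] 0) (𝓝 x) := by
  have : Continuous (fun t : ℝ => x + t • v) := by fun_prop
  have h := this.tendsto 0
  simp only [zero_smul, add_zero] at h
  exact h.mono_left nhdsWithin_le_nhds

theorem CnOn.congr {n : ℕ} : ∀ {E : Type v} [AddCommGroup E] [Module ℝ E] [TopologicalSpace E]
    [LCSpace E] {f g : E → F} {U : Set E}, CnOn n f U → IsOpen U → EqOn g f U → CnOn n g U := by
  induction n with
  | zero => intro E _ _ _ _ f g U h hU he; exact ContinuousOn.congr h he
  | succ n ih =>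
    intro E _ _ _ _ f g U h hU he
    obtain ⟨hc, df, hdf, hn⟩ := h
    refine ⟨hc.congr he, df, fun x hx v => ?_, hn⟩
    refine (hdf x hx v).congr' ?_
    filter_upwards [tendsto_line x v (hU.mem_nhds hx)] with t ht
    rw [he hx, he ht]

theorem CnOn.of_local [LCSpace F] {n : ℕ} : ∀ {E : Type v} [AddCommGroup E] [Module ℝ E]
    [TopologicalSpace E] [LCSpace E] {f : E → F} {U : Set E}, IsOpen U →
    (∀ x ∈ U, ∃ V : Set E, IsOpen V ∧ x ∈ V ∧ CnOn n f (U ∩ V)) → CnOn n f U := by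
  induction n with
  | zero =>
    intro E _ _ _ _ f U hU h x hx
    obtain ⟨V, hV, hxV, hf⟩ := h x hx
    exact ((hf x ⟨hx, hxV⟩).continuousAt ((hU.inter hV).mem_nhds ⟨hx, hxV⟩)).continuousWithinAt
  | succ n ih =>
    intro E _ _ _ _ f U hU h
    choose! V hV hxV hc df hdf hn using h
    refine ⟨fun x hx => ((hc x hx x ⟨hx, hxV x hx⟩).continuousAt
      ((hU.inter (hV x hx)).mem_nhds ⟨hx, hxV x hx⟩)).continuousWithinAt,
      fun p => df p.1 p, fun x hx v => hdf x hx x ⟨hx, hxV x hx⟩ v, ?_⟩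
    refine ih (hU.prod isOpen_univ) fun p hp => ⟨V p.1 ×ˢ univ, (hV p.1 hp.1).prod isOpen_univ,
      ⟨hxV p.1 hp.1, mem_univ _⟩, ?_⟩
    have hs : U ×ˢ (univ : Set E) ∩ V p.1 ×ˢ univ = (U ∩ V p.1) ×ˢ univ := by
      rw [prod_inter_prod, univ_inter]
    rw [hs]
    refine (hn p.1 hp.1).congr ((hU.inter (hV p.1 hp.1)).prod isOpen_univ) ?_
    rintro ⟨y, v⟩ ⟨⟨hyU, hyV⟩, -⟩
    exact tendsto_nhds_unique (hdf y hyU y ⟨hyU, hxV y hyU⟩ v) (hdf p.1 hp.1 y ⟨hyU, hyV⟩ v)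

theorem CnOn.clm_comp (L : F →L[ℝ] K) {n : ℕ} : ∀ {E : Type v} [AddCommGroup E] [Module ℝ E]
    [TopologicalSpace E] {f : E → F} {U : Set E}, CnOn n f U → CnOn n (fun x => L (f x)) U := by
  induction n with
  | zero => intro E _ _ _ f U h; exact L.continuous.comp_continuousOn h
  | succ n ih =>
    intro E _ _ _ f U h
    obtain ⟨hc, df, hdf, hn⟩ := h
    refine ⟨L.continuous.comp_continuousOn hc, fun p => L (df p), fun x hx v => ?_, ih hn⟩
    refine ((L.continuous.tendsto _).comp (hdf x hx v)).congr fun t => ?_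
    simp

theorem CnOn.of_clm [LCSpace F] {n : ℕ} : ∀ {E : Type v} [AddCommGroup E] [Module ℝ E]
    [TopologicalSpace E] [LCSpace E] (L : E →L[ℝ] F) (U : Set E), CnOn n L U := by
  induction n with
  | zero => intro E _ _ _ _ L U; exact L.continuous.continuousOn
  | succ n ih =>
    intro E _ _ _ _ L U
    refine ⟨L.continuous.continuousOn, fun p => L p.2, fun x _ v => ?_,
      ih (L.comp (ContinuousLinearMap.snd ℝ E E)) _⟩
    refine tendsto_const_nhds.congr' ?_
    filter_upwards [self_mem_nhdsWithin] with t ht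
    have ht : t ≠ 0 := ht
    simp [smul_smul, inv_mul_cancel₀ ht]

theorem CnOn.prodMk {n : ℕ} : ∀ {E : Type v} [AddCommGroup E] [Module ℝ E]
    [TopologicalSpace E] {f : E → F} {g : E → K} {U : Set E}, CnOn n f U → CnOn n g U →
    CnOn n (fun x => (f x, g x)) U := by
  induction n with
  | zero => intro E _ _ _ f g U hf hg; exact ContinuousOn.prodMk hf hg
  | succ n ih =>
    intro E _ _ _ f g U hf hg
    obtain ⟨hc, df, hdf, hn⟩ := hf
    obtain ⟨hc', dg, hdg, hn'⟩ := hg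
    refine ⟨hc.prodMk hc', fun p => (df p, dg p), fun x hx v => ?_, ih hn hn'⟩
    exact (hdf x hx v).prodMk_nhds (hdg x hx v)

theorem exists_closed_convex_nhds [LCSpace F] {y : F} {W : Set F} (hW : W ∈ 𝓝 y) :
    ∃ C ∈ 𝓝 y, IsClosed C ∧ Convex ℝ C ∧ C ⊆ W := by
  obtain ⟨W', hW', hcl, hsub⟩ := exists_mem_nhds_isClosed_subset hW
  obtain ⟨C, hC, hconv, hCsub⟩ :=
    (locallyConvexSpace_iff_exists_convex_subset ℝ F).1 inferInstance y W' hW'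
  exact ⟨closure C, mem_of_superset hC subset_closure, isClosed_closure, hconv.closure,
    (closure_minimal hCsub hcl).trans hsub⟩

theorem slope_mem_of_lineDeriv [LCSpace F] {g : ℝ → F} {g' : ℝ → F} {C : Set F} {t : ℝ}
    (ht : t ≠ 0) (hC : IsClosed C) (hconv : Convex ℝ C)
    (hg : ∀ s ∈ uIcc 0 t, Tendsto (fun h : ℝ => h⁻¹ • (g (s + h) - g s)) (𝓝[≠] 0) (𝓝 (g' s)))
    (hg' : ∀ s ∈ uIcc 0 t, g' s ∈ C) : t⁻¹ • (g t - g 0) ∈ C := by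
  by_contra hcon
  obtain ⟨L, r, hr, hr'⟩ := geometric_hahn_banach_closed_point hconv hC hcon
  have hd : ∀ s ∈ uIcc 0 t, HasDerivAt (fun s => L (g s)) (L (g' s)) s := by
    intro s hs
    rw [hasDerivAt_iff_tendsto_slope_zero]
    refine ((L.continuous.tendsto _).comp (hg s hs)).congr fun h => ?_
    simp
  have key : ∃ s ∈ uIcc 0 t, L (g' s) = t⁻¹ * (L (g t) - L (g 0)) := by
    rcases lt_or_gt_of_ne ht with h | h
    · rw [uIcc_of_ge h.le] at hd ⊢
      obtain ⟨s, hs, he⟩ := exists_hasDerivAt_eq_slope (fun s => L (g s)) (fun s => L (g' s)) h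
        (fun s hs => (hd s hs).continuousAt.continuousWithinAt)
        (fun s hs => hd s (Ioo_subset_Icc_self hs))
      refine ⟨s, Ioo_subset_Icc_self hs, he.trans ?_⟩
      field_simp
      ring
    · rw [uIcc_of_le h.le] at hd ⊢
      obtain ⟨s, hs, he⟩ := exists_hasDerivAt_eq_slope (fun s => L (g s)) (fun s => L (g' s)) h
        (fun s hs => (hd s hs).continuousAt.continuousWithinAt)
        (fun s hs => hd s (Ioo_subset_Icc_self hs))
      refine ⟨s, Ioo_subset_Icc_self hs, he.trans ?_⟩
      rw [sub_zero, div_eq_inv_mul]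
  obtain ⟨s, hs, he⟩ := key
  have h1 := hr _ (hg' s hs)
  rw [he] at h1
  simp only [map_smul, map_sub, smul_eq_mul] at hr'
  exact absurd (h1.trans hr') (lt_irrefl _)

theorem tendsto_slope_of_dirDeriv [LCSpace F] [LCSpace K] {g : F → K} {dg : F × F → K} {V : Set F}
    (hV : IsOpen V) (hdg : ∀ y ∈ V, ∀ w, Tendsto (fun t : ℝ => t⁻¹ • (g (y + t • w) - g y))
      (𝓝[≠] 0) (𝓝 (dg (y, w)))) (hc : ContinuousOn dg (V ×ˢ univ)) {y : F} (hy : y ∈ V)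
    {w : F} {W : ℝ → F} (hW : Tendsto W (𝓝[≠] 0) (𝓝 w)) :
    Tendsto (fun t : ℝ => t⁻¹ • (g (y + t • W t) - g y)) (𝓝[≠] 0) (𝓝 (dg (y, w))) := by
  intro N hN
  obtain ⟨C, hCn, hCc, hCv, hCN⟩ := exists_closed_convex_nhds hN
  have hopen : IsOpen (V ×ˢ (univ : Set F)) := hV.prod isOpen_univ
  have hpre : (V ×ˢ univ) ∩ dg ⁻¹' C ∈ 𝓝 ((y, w) : F × F) := by
    have h0 : (V ×ˢ univ : Set (F × F)) ∈ 𝓝 (y, w) := hopen.mem_nhds ⟨hy, mem_univ _⟩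
    exact inter_mem h0 ((hc.continuousAt h0).preimage_mem_nhds hCn)
  rw [nhds_prod_eq] at hpre
  obtain ⟨A, hA, B, hB, hAB⟩ := mem_prod_iff.1 hpre
  obtain ⟨A', hA', hA'v, hA'A⟩ :=
    (locallyConvexSpace_iff_exists_convex_subset ℝ F).1 inferInstance y A hA
  have hlim : Tendsto (fun t : ℝ => y + t • W t) (𝓝[≠] 0) (𝓝 y) := by
    have h1 : Tendsto (fun t : ℝ => t) (𝓝[≠] 0) (𝓝 0) := nhdsWithin_le_nhds
    simpa using tendsto_const_nhds.add (h1.smul hW)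
  rw [Filter.mem_map]
  filter_upwards [hlim hA', hW hB, self_mem_nhdsWithin] with t htA htB ht
  have ht : t ≠ 0 := ht
  have hseg : ∀ s ∈ uIcc 0 t, y + s • W t ∈ A' := by
    intro s hs
    have hs' : s ∈ segment ℝ 0 t := by rwa [segment_eq_uIcc]
    obtain ⟨a, b, ha, hb, hab, rfl⟩ := hs'
    have := hA'v (mem_of_mem_nhds hA') htA ha hb hab
    convert this using 1
    have hb' : a = 1 - b := by linarith
    subst hb'
    simp only [smul_eq_mul]
    module
  have hmem : ∀ s ∈ uIcc 0 t, (y + s • W t, W t) ∈ (V ×ˢ univ) ∩ dg ⁻¹' C := fun s hs =>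
    hAB ⟨hA'A (hseg s hs), htB⟩
  have := slope_mem_of_lineDeriv (g := fun s => g (y + s • W t))
    (g' := fun s => dg (y + s • W t, W t)) ht hCc hCv
    (fun s hs => by
      refine (hdg _ (hmem s hs).1.1 (W t)).congr fun h => ?_
      simp only [add_smul, add_assoc])
    (fun s hs => (hmem s hs).2)
  simp only [zero_smul, add_zero] at this
  exact hCN this

/-- The chain rule. -/
theorem CnOn.comp [LCSpace K] {n : ℕ} : ∀ {E : Type v} [AddCommGroup E] [Module ℝ E]
    [TopologicalSpace E] [LCSpace E] {F : Type w} [AddCommGroup F] [Module ℝ F]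
    [TopologicalSpace F] [LCSpace F] {g : F → K} {f : E → F} {V : Set F} {U : Set E},
    CnOn n g V → CnOn n f U → IsOpen U → IsOpen V → MapsTo f U V →
    CnOn n (fun x => g (f x)) U := by
  induction n with
  | zero => intro E _ _ _ _ F _ _ _ _ g f V U hg hf _ _ hm; exact ContinuousOn.comp hg hf hm
  | succ n ih =>
    intro E _ _ _ _ F _ _ _ _ g f V U hg hf hU hV hm
    have hf0 := hf
    obtain ⟨hgc, dg, hdg, hgn⟩ := hg
    obtain ⟨hfc, df, hdf, hfn⟩ := hf
    refine ⟨hgc.comp hfc hm, fun p => dg (f p.1, df p), fun x hx v => ?_, ?_⟩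
    · refine (tendsto_slope_of_dirDeriv hV hdg hgn.continuousOn (hm hx) (hdf x hx v)).congr' ?_
      filter_upwards [self_mem_nhdsWithin] with t ht
      have ht : t ≠ 0 := ht
      rw [smul_smul, mul_inv_cancel₀ ht, one_smul, add_sub_cancel]
    · have hfst : CnOn n (fun p : E × E => f p.1) (U ×ˢ univ) := by
        -- lower the order of differentiability of `f` and precompose with the projection
        have aux : ∀ (m : ℕ) {E : Type v} [AddCommGroup E] [Module ℝ E] [TopologicalSpace E]
            {f : E → F} {U : Set E}, CnOn (m + 1) f U → CnOn m f U := by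
          intro m
          induction m with
          | zero => intro E _ _ _ f U h; exact h.1
          | succ m ihm =>
            intro E _ _ _ f U h
            obtain ⟨hc, df, hdf, hn⟩ := h
            exact ⟨hc, df, hdf, ihm hn⟩
        have aux2 : ∀ (m : ℕ) {E E' : Type v} [AddCommGroup E] [Module ℝ E] [TopologicalSpace E]
            [AddCommGroup E'] [Module ℝ E'] [TopologicalSpace E'] {f : E → F} {U : Set E}
            (L : E' →L[ℝ] E), CnOn m f U → CnOn m (fun x => f (L x)) (L ⁻¹' U) := by
          intro m
          induction m with
          | zero =>
            intro E E' _ _ _ _ _ _ f U L h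
            exact ContinuousOn.comp h L.continuous.continuousOn (mapsTo_preimage _ _)
          | succ m ihm =>
            intro E E' _ _ _ _ _ _ f U L h
            obtain ⟨hc, df, hdf, hn⟩ := h
            refine ⟨hc.comp L.continuous.continuousOn (mapsTo_preimage _ _),
              fun p => df (L p.1, L p.2), fun x hx v => ?_, ?_⟩
            · refine (hdf (L x) hx (L v)).congr fun t => ?_
              simp
            · refine (ihm (L.prodMap L) hn).mono ?_
              rintro ⟨x, v⟩ ⟨hx, -⟩
              exact ⟨hx, mem_univ _⟩
        refine (aux2 n (ContinuousLinearMap.fst ℝ E E) (aux n hf0)).mono ?_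
        rintro p ⟨hp, -⟩
        exact hp
      exact ih hgn (hfst.prodMk hfn) (hU.prod isOpen_univ) (hV.prod isOpen_univ)
        fun p hp => ⟨hm hp.1, mem_univ _⟩

/-- A map with values in a closed subspace is of class `C^n` if it is so as a map to the ambient
space. -/
theorem CnOn.of_subtype [LCSpace F] {P : Submodule ℝ F} (hP : IsClosed (P : Set F)) {n : ℕ} :
    ∀ {E : Type v} [AddCommGroup E] [Module ℝ E] [TopologicalSpace E] [LCSpace E]
    {f : E → P} {U : Set E}, IsOpen U → CnOn n (fun x => (f x : F)) U → CnOn n f U := by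
  classical
  induction n with
  | zero => intro E _ _ _ _ f U _ h; exact IsInducing.subtypeVal.continuousOn_iff.2 h
  | succ n ih =>
    intro E _ _ _ _ f U hU h
    obtain ⟨hc, df, hdf, hn⟩ := h
    have hmem : ∀ x ∈ U, ∀ v, df (x, v) ∈ P := fun x hx v =>
      hP.mem_of_tendsto (hdf x hx v) (Eventually.of_forall fun t =>
        P.smul_mem _ (P.sub_mem (f _).2 (f _).2))
    refine ⟨IsInducing.subtypeVal.continuousOn_iff.2 hc,
      fun p => if hp : df p ∈ P then ⟨df p, hp⟩ else 0, fun x hx v => ?_, ?_⟩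
    · simp only [dif_pos (hmem x hx v)]
      rw [tendsto_subtype_rng]
      exact hdf x hx v
    · refine ih (hU.prod isOpen_univ) (hn.congr (hU.prod isOpen_univ) ?_)
      rintro ⟨x, v⟩ ⟨hx, -⟩
      simp only [dif_pos (hmem x hx v)]

end Calculus

/-! ### Manifolds modelled on locally convex spaces -/

/-- A chart of a topological space: a homeomorphism from an open subset onto an open subset of a
Hausdorff locally convex space. The model space belongs to the chart and may vary with it. -/
structure LCChart (X : Type u) [TopologicalSpace X] where
  Model : Type u
  [instAddCommGroup : AddCommGroup Model]
  [instModule : Module ℝ Model]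
  [instTopologicalSpace : TopologicalSpace Model]
  [instLCSpace : LCSpace Model]
  homeo : OpenPartialHomeomorph X Model

attribute [instance] LCChart.instAddCommGroup LCChart.instModule LCChart.instTopologicalSpace
  LCChart.instLCSpace

namespace LCChart

variable {X : Type u} [TopologicalSpace X] {Y : Type u} [TopologicalSpace Y]

/-- The coordinate change from `c` to `d` is smooth. -/
def SmoothTo (c d : LCChart X) : Prop :=
  SmoothlyOn (fun y => d.homeo (c.homeo.symm y)) (c.homeo.target ∩ c.homeo.symm ⁻¹' d.homeo.source)

theorem isOpen_overlap (c : LCChart X) {V : Set X} (hV : IsOpen V) :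
    IsOpen (c.homeo.target ∩ c.homeo.symm ⁻¹' V) :=
  c.homeo.isOpen_inter_preimage_symm hV

theorem SmoothTo.trans_of_forall {c d : LCChart X}
    (h : ∀ x ∈ c.homeo.source ∩ d.homeo.source, ∃ e : LCChart X, x ∈ e.homeo.source ∧
      c.SmoothTo e ∧ e.SmoothTo d) : c.SmoothTo d := by
  intro n
  refine CnOn.of_local (c.isOpen_overlap d.homeo.open_source) fun y hy => ?_
  obtain ⟨e, hxe, hce, hed⟩ := h (c.homeo.symm y) ⟨c.homeo.map_target hy.1, hy.2⟩
  refine ⟨c.homeo.target ∩ c.homeo.symm ⁻¹' e.homeo.source, c.isOpen_overlap e.homeo.open_source,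
    ⟨hy.1, hxe⟩, ?_⟩
  have hop := (c.isOpen_overlap d.homeo.open_source).inter (c.isOpen_overlap e.homeo.open_source)
  refine (CnOn.comp (hed n) ((hce n).mono (inter_subset_right)) hop
    (e.isOpen_overlap d.homeo.open_source) ?_).congr hop ?_
  · rintro z ⟨⟨hz, hzd⟩, -, hze⟩
    refine ⟨e.homeo.map_source hze, ?_⟩
    simpa only [mem_preimage, e.homeo.left_inv hze] using hzd
  · rintro z ⟨-, -, hze⟩
    simp only [e.homeo.left_inv hze]

/-- The product of two charts. -/
def prod (c : LCChart X) (d : LCChart Y) : LCChart (X × Y) where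
  Model := c.Model × d.Model
  homeo := c.homeo.prod d.homeo

theorem SmoothTo.prod {c c' : LCChart X} {d d' : LCChart Y} (h : c.SmoothTo c')
    (h' : d.SmoothTo d') : (c.prod d).SmoothTo (c'.prod d') := by
  intro n
  have hopen : IsOpen ((c.homeo.target ∩ c.homeo.symm ⁻¹' c'.homeo.source) ×ˢ
      (d.homeo.target ∩ d.homeo.symm ⁻¹' d'.homeo.source)) :=
    (c.isOpen_overlap c'.homeo.open_source).prod (d.isOpen_overlap d'.homeo.open_source)
  have h1 : CnOn n (fun p : c.Model × d.Model => c'.homeo (c.homeo.symm p.1))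
      ((c.homeo.target ∩ c.homeo.symm ⁻¹' c'.homeo.source) ×ˢ
      (d.homeo.target ∩ d.homeo.symm ⁻¹' d'.homeo.source)) :=
    CnOn.comp (g := fun y => c'.homeo (c.homeo.symm y))
      (f := fun p : c.Model × d.Model => p.1) (h n) (CnOn.of_clm (ContinuousLinearMap.fst ℝ c.Model d.Model) _) hopen
      (c.isOpen_overlap c'.homeo.open_source) fun p hp => hp.1
  have h2 : CnOn n (fun p : c.Model × d.Model => d'.homeo (d.homeo.symm p.2))
      ((c.homeo.target ∩ c.homeo.symm ⁻¹' c'.homeo.source) ×ˢ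
      (d.homeo.target ∩ d.homeo.symm ⁻¹' d'.homeo.source)) :=
    CnOn.comp (g := fun y => d'.homeo (d.homeo.symm y))
      (f := fun p : c.Model × d.Model => p.2) (h' n) (CnOn.of_clm (ContinuousLinearMap.snd ℝ c.Model d.Model) _) hopen
      (d.isOpen_overlap d'.homeo.open_source) fun p hp => hp.2
  refine (h1.prodMk h2).mono ?_
  rintro ⟨y, z⟩ ⟨⟨hy, hz⟩, hy', hz'⟩
  exact ⟨⟨hy, hy'⟩, hz, hz'⟩

/-- The chart `c` is adapted to the subset `N` through the closed subspace `F` of its model space: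
on the domain of `c`, the points of `N` are the points with coordinates in `F`. -/
structure IsAdapted (c : LCChart X) (N : Set X) (F : Submodule ℝ c.Model) : Prop where
  isClosed : IsClosed (F : Set c.Model)
  mem_iff : ∀ x ∈ c.homeo.source, x ∈ N ↔ c.homeo x ∈ F

open Classical in
/-- The restriction of an adapted chart to the subset `N`. The point `x₀` only serves as the value
of the inverse outside its domain. -/
noncomputable def restrictHomeo (c : LCChart X) {N : Set X} {F : Submodule ℝ c.Model}
    (h : c.IsAdapted N F) (x₀ : N) : OpenPartialHomeomorph N F :=
    { toFun := fun x => if hx : c.homeo x ∈ F then ⟨c.homeo x, hx⟩ else 0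
      invFun := fun y => if hy : c.homeo.symm y ∈ N then ⟨c.homeo.symm y, hy⟩ else x₀
      source := {x | (x : X) ∈ c.homeo.source}
      target := {y | (y : c.Model) ∈ c.homeo.target}
      map_source' := by
        intro x hx
        have hF := (h.mem_iff x hx).1 x.2
        simp only [dif_pos hF]
        exact c.homeo.map_source hx
      map_target' := by
        intro y hy
        have hs := c.homeo.map_target hy
        have hN := (h.mem_iff _ hs).2 (by rw [c.homeo.right_inv hy]; exact y.2)
        simp only [dif_pos hN]
        exact hs
      left_inv' := by
        intro x hx
        have hF := (h.mem_iff x hx).1 x.2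
        have he : c.homeo.symm (c.homeo x) = x := c.homeo.left_inv hx
        have hN : c.homeo.symm (c.homeo x) ∈ N := by rw [he]; exact x.2
        simp only [dif_pos hF, dif_pos hN]
        exact Subtype.ext he
      right_inv' := by
        intro y hy
        have hs := c.homeo.map_target hy
        have he : c.homeo (c.homeo.symm y) = y := c.homeo.right_inv hy
        have hF : c.homeo (c.homeo.symm y) ∈ F := by rw [he]; exact y.2
        have hN := (h.mem_iff _ hs).2 hF
        simp only [dif_pos hN, dif_pos hF]
        exact Subtype.ext he
      open_source := c.homeo.open_source.preimage continuous_subtype_val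
      open_target := c.homeo.open_target.preimage continuous_subtype_val
      continuousOn_toFun := by
        refine IsInducing.subtypeVal.continuousOn_iff.2 ?_
        refine (c.homeo.continuousOn.comp continuous_subtype_val.continuousOn
          (fun x hx => hx)).congr ?_
        intro x hx
        have hF := (h.mem_iff x hx).1 x.2
        simp only [Function.comp_apply, dif_pos hF]
      continuousOn_invFun := by
        refine IsInducing.subtypeVal.continuousOn_iff.2 ?_
        refine (c.homeo.symm.continuousOn.comp continuous_subtype_val.continuousOn
          (fun x hx => hx)).congr ?_
        intro y hy
        have hs := c.homeo.map_target hy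
        have hN := (h.mem_iff _ hs).2 (by rw [c.homeo.right_inv hy]; exact y.2)
        simp only [Function.comp_apply, dif_pos hN] }

/-- The restriction of an adapted chart to the subset `N`, as a chart of `N` modelled on `F`. -/
noncomputable def restrict (c : LCChart X) {N : Set X} {F : Submodule ℝ c.Model}
    (h : c.IsAdapted N F) (x₀ : N) : LCChart N where
  Model := F
  homeo := c.restrictHomeo h x₀

theorem SmoothTo.restrict {c d : LCChart X} {N : Set X} {F : Submodule ℝ c.Model}
    {F' : Submodule ℝ d.Model} (hcd : c.SmoothTo d) (h : c.IsAdapted N F) (h' : d.IsAdapted N F')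
    (x₀ x₁ : N) : (c.restrict h x₀).SmoothTo (d.restrict h' x₁) := by
  intro n
  change CnOn n (fun y : F => d.restrictHomeo h' x₁ ((c.restrictHomeo h x₀).symm y))
    ((c.restrictHomeo h x₀).target ∩
      (c.restrictHomeo h x₀).symm ⁻¹' (d.restrictHomeo h' x₁).source)
  have hop := (c.restrictHomeo h x₀).isOpen_inter_preimage_symm (d.restrictHomeo h' x₁).open_source
  have key : ∀ y ∈ (c.restrictHomeo h x₀).target ∩
      (c.restrictHomeo h x₀).symm ⁻¹' (d.restrictHomeo h' x₁).source,
      c.homeo.symm (y : c.Model) ∈ d.homeo.source ∧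
      (d.restrictHomeo h' x₁ ((c.restrictHomeo h x₀).symm y) : d.Model) =
        d.homeo (c.homeo.symm (y : c.Model)) := by
    rintro y ⟨hy, hy'⟩
    change (y : c.Model) ∈ c.homeo.target at hy
    have hs := c.homeo.map_target hy
    have hN := (h.mem_iff _ hs).2 (by rw [c.homeo.right_inv hy]; exact y.2)
    have he : (c.restrictHomeo h x₀).symm y = ⟨c.homeo.symm (y : c.Model), hN⟩ := dif_pos hN
    rw [mem_preimage, he] at hy'
    change c.homeo.symm (y : c.Model) ∈ d.homeo.source at hy'
    refine ⟨hy', ?_⟩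
    rw [he]
    have hF := (h'.mem_iff _ hy').1 hN
    have : d.restrictHomeo h' x₁ ⟨c.homeo.symm (y : c.Model), hN⟩ =
      ⟨d.homeo (c.homeo.symm (y : c.Model)), hF⟩ := dif_pos hF
    rw [this]
  refine CnOn.of_subtype (P := F') h'.isClosed hop ?_
  refine (CnOn.comp (hcd n) (CnOn.of_clm F.subtypeL _) hop
    (c.isOpen_overlap d.homeo.open_source) ?_).congr hop fun y hy => (key y hy).2
  intro y hy
  exact ⟨hy.1, (key y hy).1⟩

end LCChart

/-- A smooth atlas on a topological space. A manifold is a Hausdorff space with a smooth atlas. -/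
structure SmoothAtlas (X : Type u) [TopologicalSpace X] where
  charts : Set (LCChart X)
  cover : ∀ x, ∃ c ∈ charts, x ∈ c.homeo.source
  compatible : ∀ c ∈ charts, ∀ d ∈ charts, c.SmoothTo d

namespace SmoothAtlas

variable {X Y : Type u} [TopologicalSpace X] [TopologicalSpace Y]

/-- The charts of the smooth structure, i.e. of the maximal atlas. -/
def IsChart (A : SmoothAtlas X) (c : LCChart X) : Prop :=
  ∀ d ∈ A.charts, c.SmoothTo d ∧ d.SmoothTo c

theorem IsChart.smoothTo {A : SmoothAtlas X} {c d : LCChart X} (hc : A.IsChart c)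
    (hd : A.IsChart d) : c.SmoothTo d :=
  LCChart.SmoothTo.trans_of_forall fun x _ =>
    let ⟨e, he, hx⟩ := A.cover x
    ⟨e, hx, (hc e he).1, (hd e he).2⟩

/-- Two atlases define the same smooth structure, i.e. have the same maximal atlas. -/
def Equivalent (A B : SmoothAtlas X) : Prop := ∀ c, A.IsChart c ↔ B.IsChart c

/-- The product manifold. -/
def prod (A : SmoothAtlas X) (B : SmoothAtlas Y) : SmoothAtlas (X × Y) where
  charts := image2 LCChart.prod A.charts B.charts
  cover := fun p =>
    let ⟨c, hc, hx⟩ := A.cover p.1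
    let ⟨d, hd, hy⟩ := B.cover p.2
    ⟨c.prod d, ⟨c, hc, d, hd, rfl⟩, ⟨hx, hy⟩⟩
  compatible := by
    rintro _ ⟨c, hc, d, hd, rfl⟩ _ ⟨c', hc', d', hd', rfl⟩
    exact (A.compatible c hc c' hc').prod (B.compatible d hd d' hd')

/-- The subset `N` is a (not necessarily split) submanifold: around each of its points there is a
chart that maps `N` to a closed subspace of the model space. -/
def IsSubmanifold (A : SmoothAtlas X) (N : Set X) : Prop :=
  ∀ x ∈ N, ∃ c, A.IsChart c ∧ x ∈ c.homeo.source ∧ ∃ F : Submodule ℝ c.Model, c.IsAdapted N F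

/-- The manifold structure of a submanifold, in its relative topology. -/
noncomputable def IsSubmanifold.atlas {A : SmoothAtlas X} {N : Set X} (hN : A.IsSubmanifold N) :
    SmoothAtlas N where
  charts := {d | ∃ (c : LCChart X) (F : Submodule ℝ c.Model) (h : c.IsAdapted N F) (x₀ : N),
    A.IsChart c ∧ d = c.restrict h x₀}
  cover := fun x =>
    let ⟨c, hc, hx, F, h⟩ := hN x x.2
    ⟨c.restrict h x, ⟨c, F, h, x, hc, rfl⟩, hx⟩
  compatible := by
    rintro _ ⟨c, F, h, x₀, hc, rfl⟩ _ ⟨d, F', h', x₁, hd, rfl⟩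
    exact (hc.smoothTo hd).restrict h h' x₀ x₁

/-- The map `f` is smooth on the open subset `U`. -/
def SmoothOn (A : SmoothAtlas X) (B : SmoothAtlas Y) (f : X → Y) (U : Set X) : Prop :=
  ContinuousOn f U ∧ ∀ c ∈ A.charts, ∀ d ∈ B.charts,
    SmoothlyOn (fun y => d.homeo (f (c.homeo.symm y)))
      (c.homeo.target ∩ c.homeo.symm ⁻¹' (U ∩ f ⁻¹' d.homeo.source))

/-- Smooth maps between manifolds. -/
def Smooth (A : SmoothAtlas X) (B : SmoothAtlas Y) (f : X → Y) : Prop := A.SmoothOn B f univ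

/-- The homeomorphism `ψ` from an open subset of `X` onto an open subset of `Y` is a
diffeomorphism. -/
def IsDiffeo (A : SmoothAtlas X) (B : SmoothAtlas Y) (ψ : OpenPartialHomeomorph X Y) : Prop :=
  A.SmoothOn B ψ ψ.source ∧ B.SmoothOn A ψ.symm ψ.target

/-- Smooth submersions: smooth maps which, in suitable charts around each point, are given by a
continuous linear surjection with a continuous linear right inverse, i.e. by the projection onto
one factor of a topological direct sum. -/
def IsSubmersion (A : SmoothAtlas X) (B : SmoothAtlas Y) (f : X → Y) : Prop :=
  A.Smooth B f ∧ ∀ x, ∃ c d, A.IsChart c ∧ B.IsChart d ∧ x ∈ c.homeo.source ∧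
    MapsTo f c.homeo.source d.homeo.source ∧
    ∃ (p : c.Model →L[ℝ] d.Model) (s : d.Model →L[ℝ] c.Model), (∀ z, p (s z) = z) ∧
      ∀ y ∈ c.homeo.source, d.homeo (f y) = p (c.homeo y)

end SmoothAtlas

/-! ### Stratifications -/

/-- A stratification of the space `X` with strata `P i`. -/
structure Stratification {X : Type u} [TopologicalSpace X] {ι : Type v} (P : ι → Set X) where
  t2Space : T2Space X
  nonempty : ∀ i, (P i).Nonempty
  pairwiseDisjoint : Pairwise fun i j => Disjoint (P i) (P j)
  iUnion_eq : ⋃ i, P i = univ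
  /-- The manifold structure of the strata, with respect to the relative topology. -/
  atlas : ∀ i, SmoothAtlas (P i)
  isLocallyClosed : ∀ i, IsLocallyClosed (P i)
  frontier_condition : ∀ i j, Disjoint (P i) (P j) → (P i ∩ closure (P j)).Nonempty →
    P i ⊆ closure (P j) \ P j ∧ Disjoint (P j) (closure (P i))

/-! ### Lie groups and their actions -/

/-- The atlas turns the (Hausdorff) group `G` into a Lie group. -/
structure IsLieGroup {G : Type u} [Group G] [TopologicalSpace G] (𝓖 : SmoothAtlas G) : Prop where
  smooth_mul : (𝓖.prod 𝓖).Smooth 𝓖 fun p => p.1 * p.2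
  smooth_inv : 𝓖.Smooth 𝓖 fun g => g⁻¹

/-- With respect to the atlas `𝓠` on `G ⧸ H`, the projection `G → G ⧸ H` is a smooth principal
bundle with structure group the Lie subgroup `H`: locally there are `H`-equivariant smooth
trivialisations. -/
def IsPrincipalBundle {G : Type u} [Group G] [TopologicalSpace G] (𝓖 : SmoothAtlas G)
    (H : Subgroup G) (hH : 𝓖.IsSubmanifold (H : Set G)) (𝓠 : SmoothAtlas (G ⧸ H)) : Prop :=
  ∀ q : G ⧸ H, ∃ (U : Set (G ⧸ H)) (τ : OpenPartialHomeomorph ((G ⧸ H) × (H : Set G)) G),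
    q ∈ U ∧ IsOpen U ∧ τ.source = U ×ˢ univ ∧ τ.target = {g : G | (g : G ⧸ H) ∈ U} ∧
    (∀ r ∈ U, ∀ h : (H : Set G), ((τ (r, h) : G) : G ⧸ H) = r) ∧
    (∀ r ∈ U, ∀ h k : (H : Set G),
      τ (r, ⟨(h : G) * (k : G), H.mul_mem h.2 k.2⟩) = τ (r, h) * (k : G)) ∧
    (𝓠.prod hH.atlas).IsDiffeo 𝓖 τ

section Action

variable (G : Type u) {M : Type u} [Group G] [MulAction G M]

/-- The conjugacy class `(H)` of a subgroup. -/
def conjClass {G : Type u} [Group G] (H : Subgroup G) : Set (Subgroup G) :=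
  {K | ∃ a : G, K = H.map (MulAut.conj a).toMonoidHom}

/-- `(H) ≤ (K)`: the subgroup `H` is conjugate to a subgroup of `K`. -/
def IsSubconjugate {G : Type u} [Group G] (H K : Subgroup G) : Prop :=
  ∃ a : G, H.map (MulAut.conj a).toMonoidHom ≤ K

/-- The orbit type `(G_m)` of a point. -/
def orbitType (m : M) : Set (Subgroup G) := conjClass (MulAction.stabilizer G m)

/-- The set of orbit types of the action. -/
abbrev OrbitTypes (M : Type u) [MulAction G M] : Type u := range (orbitType G : M → _)

/-- The subset `M_{(H)}` of orbit type `τ = (H)`. -/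
def orbitTypeSubset (M : Type u) [MulAction G M] (τ : Set (Subgroup G)) : Set M :=
  {m | orbitType G m = τ}

/-- The subset `M_{≥ (H)}` of points whose stabilizer contains a conjugate of `H`. -/
def orbitTypeAbove {G : Type u} [Group G] (M : Type u) [MulAction G M] (H : Subgroup G) : Set M :=
  {m | IsSubconjugate H (MulAction.stabilizer G m)}

/-- The orbit space `M / G` (with the quotient topology). -/
abbrev OrbitSpace (M : Type u) [MulAction G M] : Type u := Quotient (MulAction.orbitRel G M)

/-- The piece `M_{(H)} / G` of the orbit space. -/
def orbitSpacePiece (M : Type u) [MulAction G M] (τ : Set (Subgroup G)) : Set (OrbitSpace G M) :=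
  Quotient.mk (MulAction.orbitRel G M) '' orbitTypeSubset G M τ

/-- The canonical projection `M_{(H)} → M_{(H)} / G`. -/
def pieceProj (M : Type u) [MulAction G M] (τ : Set (Subgroup G)) (m : orbitTypeSubset G M τ) :
    orbitSpacePiece G M τ :=
  ⟨Quotient.mk (MulAction.orbitRel G M) (m : M), mem_image_of_mem _ m.2⟩

end Action

/-- A proper action: preimages of compact sets under `(g, m) ↦ (g • m, m)` are compact. -/
def IsProperAction (G M : Type u) [Group G] [TopologicalSpace G] [TopologicalSpace M]
    [MulAction G M] : Prop :=
  Continuous (fun p : G × M => (p.1 • p.2, p.2)) ∧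
    ∀ K : Set (M × M), IsCompact K → IsCompact ((fun p : G × M => (p.1 • p.2, p.2)) ⁻¹' K)

/-- `S` is a slice at the point `m`. -/
structure IsSlice {G M : Type u} [Group G] [TopologicalSpace G] [TopologicalSpace M]
    [MulAction G M] (𝓖 : SmoothAtlas G) (𝓜 : SmoothAtlas M) (m : M) (S : Set M) : Prop where
  submanifold : 𝓜.IsSubmanifold S
  mem : m ∈ S
  invariant : ∀ g ∈ MulAction.stabilizer G m, ∀ s ∈ S, g • s ∈ S
  mem_stabilizer : ∀ g : G, (∃ s ∈ S, g • s ∈ S) → g ∈ MulAction.stabilizer G m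
  /-- The stabilizer is a principal Lie subgroup, and its bundle has a local section `χ` over an
  open neighborhood `U` of the identity coset such that `(q, s) ↦ χ q • s` is a diffeomorphism
  from `U × S` onto an open neighborhood of `m`. -/
  locally_product : ∃ (hH : 𝓖.IsSubmanifold (MulAction.stabilizer G m : Set G))
    (𝓠 : SmoothAtlas (G ⧸ MulAction.stabilizer G m)),
    IsPrincipalBundle 𝓖 (MulAction.stabilizer G m) hH 𝓠 ∧
    ∃ (U : Set (G ⧸ MulAction.stabilizer G m)) (χ : G ⧸ MulAction.stabilizer G m → G)
      (ψ : OpenPartialHomeomorph ((G ⧸ MulAction.stabilizer G m) × S) M),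
      IsOpen U ∧ ((1 : G) : G ⧸ MulAction.stabilizer G m) ∈ U ∧
      𝓠.SmoothOn 𝓖 χ U ∧ (∀ q ∈ U, ((χ q : G) : G ⧸ MulAction.stabilizer G m) = q) ∧
      ψ.source = U ×ˢ univ ∧ m ∈ ψ.target ∧
      (∀ q ∈ U, ∀ s : S, ψ (q, s) = χ q • (s : M)) ∧
      (𝓠.prod submanifold.atlas).IsDiffeo 𝓜 ψ
  /-- The partial slice `S_{(G_m)}` is a closed submanifold of `S`. -/
  partial_isClosed : IsClosed {s : S | orbitType G (s : M) = orbitType G m}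
  partial_submanifold :
    submanifold.atlas.IsSubmanifold {s : S | orbitType G (s : M) = orbitType G m}

/-! ### Smooth maps between manifolds -/

/-- Constant maps are of class `C^n`. -/
theorem CnOn.const {F : Type w} [AddCommGroup F] [Module ℝ F] [TopologicalSpace F] {n : ℕ} :
    ∀ {E : Type v} [AddCommGroup E] [Module ℝ E] [TopologicalSpace E] (b : F) (U : Set E),
    CnOn n (fun _ => b) U := by
  induction n with
  | zero => exact fun b U => continuousOn_const
  | succ n ih =>
    refine fun b U => ⟨continuousOn_const, fun _ => 0, fun x _ v => ?_, ih 0 _⟩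
    simp only [sub_self, smul_zero]
    exact tendsto_const_nhds

namespace LCChart

/-- The identity chart of a locally convex space. -/
def self (E : Type u) [AddCommGroup E] [Module ℝ E] [TopologicalSpace E] [LCSpace E] :
    LCChart E where
  Model := E
  homeo := OpenPartialHomeomorph.refl E

end LCChart

namespace SmoothAtlas

/-- A locally convex space as a manifold. -/
def ofModel (E : Type u) [AddCommGroup E] [Module ℝ E] [TopologicalSpace E] [LCSpace E] :
    SmoothAtlas E where
  charts := {LCChart.self E}
  cover := fun x => ⟨_, rfl, mem_univ x⟩
  compatible := by
    rintro _ rfl _ rfl n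
    exact CnOn.of_clm (ContinuousLinearMap.id ℝ E) _

section Basic

variable {X Y Z : Type u} [TopologicalSpace X] [TopologicalSpace Y] [TopologicalSpace Z]
  {A : SmoothAtlas X} {B : SmoothAtlas Y} {C : SmoothAtlas Z}

theorem SmoothOn.mono {f : X → Y} {U V : Set X} (h : A.SmoothOn B f U) (hV : V ⊆ U) :
    A.SmoothOn B f V :=
  ⟨h.1.mono hV, fun c hc d hd n => (h.2 c hc d hd n).mono
    fun _ hy => ⟨hy.1, hV hy.2.1, hy.2.2⟩⟩

theorem Smooth.smoothOn {f : X → Y} (h : A.Smooth B f) (U : Set X) : A.SmoothOn B f U :=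
  SmoothOn.mono h (subset_univ U)

theorem Smooth.continuous {f : X → Y} (h : A.Smooth B f) : Continuous f :=
  continuousOn_univ.1 h.1

theorem SmoothOn.isOpen_inter_preimage {f : X → Y} {U : Set X} (h : A.SmoothOn B f U)
    (hU : IsOpen U) {V : Set Y} (hV : IsOpen V) : IsOpen (U ∩ f ⁻¹' V) :=
  h.1.isOpen_inter_preimage hU hV

theorem SmoothOn.congr {f g : X → Y} {U : Set X} (h : A.SmoothOn B f U) (hU : IsOpen U)
    (hg : EqOn g f U) : A.SmoothOn B g U := by
  refine ⟨h.1.congr hg, fun c hc d hd n => ?_⟩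
  have hs : U ∩ g ⁻¹' d.homeo.source = U ∩ f ⁻¹' d.homeo.source := by
    ext x
    simp only [mem_inter_iff, mem_preimage]
    exact and_congr_right fun hx => by rw [hg hx]
  rw [hs]
  refine (h.2 c hc d hd n).congr
    (c.isOpen_overlap (h.isOpen_inter_preimage hU d.homeo.open_source)) fun y hy => ?_
  simp only [hg hy.2.1]

theorem SmoothOn.of_local {f : X → Y} {U : Set X} (hU : IsOpen U)
    (h : ∀ x ∈ U, ∃ V, IsOpen V ∧ x ∈ V ∧ A.SmoothOn B f V) : A.SmoothOn B f U := by
  have hc : ContinuousOn f U := fun x hx =>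
    let ⟨V, hV, hxV, hf⟩ := h x hx
    (hf.1.continuousAt (hV.mem_nhds hxV)).continuousWithinAt
  refine ⟨hc, fun c hc' d hd n => ?_⟩
  refine CnOn.of_local (c.isOpen_overlap (hc.isOpen_inter_preimage hU d.homeo.open_source))
    fun y hy => ?_
  obtain ⟨V, hV, hxV, hf⟩ := h _ hy.2.1
  refine ⟨c.homeo.target ∩ c.homeo.symm ⁻¹' V, c.isOpen_overlap hV, ⟨hy.1, hxV⟩, ?_⟩
  exact (hf.2 c hc' d hd n).mono fun z hz => ⟨hz.1.1, hz.2.2, hz.1.2.2⟩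

theorem SmoothOn.comp {g : Y → Z} {f : X → Y} {U : Set X} {V : Set Y} (hg : B.SmoothOn C g V)
    (hf : A.SmoothOn B f U) (hU : IsOpen U) (hV : IsOpen V) (hm : MapsTo f U V) :
    A.SmoothOn C (fun x => g (f x)) U := by
  have hcont : ContinuousOn (fun x => g (f x)) U := hg.1.comp hf.1 hm
  refine ⟨hcont, fun c hc d hd n => ?_⟩
  refine CnOn.of_local (c.isOpen_overlap (hcont.isOpen_inter_preimage hU d.homeo.open_source))
    fun y hy => ?_
  obtain ⟨b, hb, hyb⟩ := B.cover (f (c.homeo.symm y))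
  have hW := c.isOpen_overlap (hf.isOpen_inter_preimage hU b.homeo.open_source)
  refine ⟨_, hW, ⟨hy.1, hy.2.1, hyb⟩, ?_⟩
  have hop := (c.isOpen_overlap
    (hcont.isOpen_inter_preimage hU d.homeo.open_source)).inter hW
  refine (CnOn.comp (hg.2 b hb d hd n) ((hf.2 c hc b hb n).mono inter_subset_right) hop
    (b.isOpen_overlap (hg.isOpen_inter_preimage hV d.homeo.open_source)) ?_).congr hop ?_
  · rintro z ⟨⟨hz, hzU, hzd⟩, -, -, hzb⟩
    refine ⟨b.homeo.map_source hzb, ?_⟩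
    rw [mem_preimage, b.homeo.left_inv hzb]
    exact ⟨hm hzU, hzd⟩
  · rintro z ⟨-, -, -, hzb⟩
    simp only [b.homeo.left_inv hzb]

theorem Smooth.comp {g : Y → Z} {f : X → Y} (hg : B.Smooth C g) (hf : A.Smooth B f) :
    A.Smooth C fun x => g (f x) :=
  SmoothOn.comp hg hf isOpen_univ isOpen_univ (mapsTo_univ _ _)

theorem Smooth.comp_smoothOn {g : Y → Z} {f : X → Y} {U : Set X} (hg : B.Smooth C g)
    (hf : A.SmoothOn B f U) (hU : IsOpen U) : A.SmoothOn C (fun x => g (f x)) U :=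
  SmoothOn.comp hg hf hU isOpen_univ (mapsTo_univ _ _)

theorem smooth_id (A : SmoothAtlas X) : A.Smooth A fun x => x :=
  ⟨continuousOn_id, fun c hc d hd n => (A.compatible c hc d hd n).mono
    fun _ hy => ⟨hy.1, hy.2.2⟩⟩

theorem smooth_const (A : SmoothAtlas X) (B : SmoothAtlas Y) (b : Y) :
    A.Smooth B fun _ => b :=
  ⟨continuousOn_const, fun _ _ d _ _ => CnOn.const (d.homeo b) _⟩

theorem smooth_snd (A : SmoothAtlas X) (B : SmoothAtlas Y) : (A.prod B).Smooth B Prod.snd := by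
  refine ⟨continuousOn_snd, ?_⟩
  rintro _ ⟨c, hc, d, hd, rfl⟩ e he n
  refine (CnOn.comp (g := fun y => e.homeo (d.homeo.symm y))
    (f := fun p : c.Model × d.Model => p.2)
    (B.compatible d hd e he n) (CnOn.of_clm (ContinuousLinearMap.snd ℝ c.Model d.Model) _)
    ((c.prod d).isOpen_overlap (e.homeo.open_source.preimage continuous_snd))
    (d.isOpen_overlap e.homeo.open_source) ?_).mono ?_
  · rintro ⟨y, z⟩ ⟨hy, hy'⟩
    exact ⟨hy.2, hy'⟩
  · rintro ⟨y, z⟩ ⟨hy, hy'⟩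
    exact ⟨hy, hy'.2⟩

theorem SmoothOn.prodMk {f : X → Y} {g : X → Z} {U : Set X} (hf : A.SmoothOn B f U)
    (hg : A.SmoothOn C g U) : A.SmoothOn (B.prod C) (fun x => (f x, g x)) U := by
  refine ⟨hf.1.prodMk hg.1, ?_⟩
  rintro c hc _ ⟨d, hd, e, he, rfl⟩ n
  exact ((hf.2 c hc d hd n).mono fun y hy => ⟨hy.1, hy.2.1, hy.2.2.1⟩).prodMk
    ((hg.2 c hc e he n).mono fun y hy => ⟨hy.1, hy.2.1, hy.2.2.2⟩)

end Basic

section Model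

variable {E F : Type u} [AddCommGroup E] [Module ℝ E] [TopologicalSpace E] [LCSpace E]
  [AddCommGroup F] [Module ℝ F] [TopologicalSpace F] [LCSpace F]

theorem smoothOn_ofModel_iff {f : E → F} {U : Set E} :
    (ofModel E).SmoothOn (ofModel F) f U ↔ SmoothlyOn f U := by
  have hs : ((LCChart.self E).homeo.target ∩ (LCChart.self E).homeo.symm ⁻¹'
      (U ∩ f ⁻¹' (LCChart.self F).homeo.source)) = U := by
    ext x
    exact ⟨fun h => h.2.1, fun h => ⟨mem_univ _, h, mem_univ _⟩⟩
  constructor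
  · intro h n
    have := h.2 _ rfl _ rfl n
    rw [hs] at this
    exact this
  · intro h
    refine ⟨h 0, ?_⟩
    rintro _ rfl _ rfl n
    rw [hs]
    exact h n

theorem smooth_clm (L : E →L[ℝ] F) : (ofModel E).Smooth (ofModel F) L :=
  smoothOn_ofModel_iff.2 fun _ => CnOn.of_clm L _

theorem smooth_prod_ofModel : ((ofModel E).prod (ofModel F)).Smooth (ofModel (E × F)) id := by
  refine ⟨continuousOn_id, ?_⟩
  rintro _ ⟨_, rfl, _, rfl, rfl⟩ _ rfl n
  exact CnOn.of_clm (ContinuousLinearMap.id ℝ (E × F)) _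

theorem smooth_add : ((ofModel E).prod (ofModel E)).Smooth (ofModel E) fun p => p.1 + p.2 :=
  Smooth.comp (g := fun p : E × E => p.1 + p.2)
    (smooth_clm (ContinuousLinearMap.fst ℝ E E + ContinuousLinearMap.snd ℝ E E))
    smooth_prod_ofModel

end Model

section Charts

variable {X Y : Type u} [TopologicalSpace X] [TopologicalSpace Y]
  {A : SmoothAtlas X} {B : SmoothAtlas Y}

theorem isChart_of_mem {c : LCChart X} (hc : c ∈ A.charts) : A.IsChart c :=
  fun d hd => ⟨A.compatible c hc d hd, A.compatible d hd c hc⟩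

theorem IsChart.smoothOn {c : LCChart X} (hc : A.IsChart c) :
    A.SmoothOn (ofModel c.Model) c.homeo c.homeo.source := by
  refine ⟨c.homeo.continuousOn, ?_⟩
  rintro d hd _ rfl n
  exact ((hc d hd).2 n).mono fun y hy => ⟨hy.1, hy.2.1⟩

theorem IsChart.smoothOn_symm {c : LCChart X} (hc : A.IsChart c) :
    (ofModel c.Model).SmoothOn A c.homeo.symm c.homeo.target := by
  refine ⟨c.homeo.symm.continuousOn, ?_⟩
  rintro _ rfl d hd n
  exact ((hc d hd).1 n).mono fun y hy => ⟨hy.2.1, hy.2.2⟩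

theorem isChart_iff {c : LCChart X} : A.IsChart c ↔
    A.SmoothOn (ofModel c.Model) c.homeo c.homeo.source ∧
    (ofModel c.Model).SmoothOn A c.homeo.symm c.homeo.target := by
  refine ⟨fun h => ⟨h.smoothOn, h.smoothOn_symm⟩, fun h d hd => ⟨fun n => ?_, fun n => ?_⟩⟩
  · exact (h.2.2 _ rfl d hd n).mono fun y hy => ⟨mem_univ _, hy⟩
  · exact (h.1.2 d hd _ rfl n).mono fun y hy => ⟨hy.1, hy.2, mem_univ _⟩

theorem smoothTo_of_smoothOn {c d : LCChart X} (h : (ofModel c.Model).SmoothOn (ofModel d.Model)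
    (fun y => d.homeo (c.homeo.symm y)) (c.homeo.target ∩ c.homeo.symm ⁻¹' d.homeo.source)) :
    c.SmoothTo d :=
  smoothOn_ofModel_iff.1 h

theorem IsChart.prod {c : LCChart X} {d : LCChart Y} (hc : A.IsChart c) (hd : B.IsChart d) :
    (A.prod B).IsChart (c.prod d) := by
  rintro _ ⟨c', hc', d', hd', rfl⟩
  exact ⟨(hc c' hc').1.prod (hd d' hd').1, (hc c' hc').2.prod (hd d' hd').2⟩

/-- The chart obtained by transporting a chart along a homeomorphism of open subsets. -/
def _root_.LCChart.transport (c : LCChart X) (ψ : OpenPartialHomeomorph X Y) : LCChart Y where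
  Model := c.Model
  homeo := ψ.symm.trans c.homeo

theorem IsChart.transport {c : LCChart X} (hc : A.IsChart c) {ψ : OpenPartialHomeomorph X Y}
    (hψ : A.IsDiffeo B ψ) : B.IsChart (c.transport ψ) := by
  refine isChart_iff.2 ⟨?_, ?_⟩
  · exact SmoothOn.comp (f := ψ.symm) (U := ψ.target ∩ ψ.symm ⁻¹' c.homeo.source) hc.smoothOn
      (hψ.2.mono inter_subset_left)
      (ψ.isOpen_inter_preimage_symm c.homeo.open_source) c.homeo.open_source fun y hy => hy.2
  · exact SmoothOn.comp (f := c.homeo.symm) (U := c.homeo.target ∩ c.homeo.symm ⁻¹' ψ.source) hψ.1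
      (hc.smoothOn_symm.mono inter_subset_left)
      (c.isOpen_overlap ψ.open_source) ψ.open_source fun y hy => hy.2

end Charts

section Submanifold

variable {X Y : Type u} [TopologicalSpace X] [TopologicalSpace Y]
  {A : SmoothAtlas X} {B : SmoothAtlas Y} {N : Set X}

theorem isChart_restrict (hN : A.IsSubmanifold N) {c : LCChart X} (hc : A.IsChart c)
    {F : Submodule ℝ c.Model} (h : c.IsAdapted N F) (x₀ : N) :
    hN.atlas.IsChart (c.restrict h x₀) :=
  isChart_of_mem ⟨c, F, h, x₀, hc, rfl⟩

theorem _root_.LCChart.IsAdapted.restrict_apply {c : LCChart X} {F : Submodule ℝ c.Model}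
    (h : c.IsAdapted N F) (x₀ : N) {x : N} (hx : (x : X) ∈ c.homeo.source) :
    ((c.restrictHomeo h x₀ x : F) : c.Model) = c.homeo x := by
  have hF := (h.mem_iff x hx).1 x.2
  exact congrArg Subtype.val (dif_pos hF : c.restrictHomeo h x₀ x = ⟨c.homeo x, hF⟩)

/-- The inclusion of a submanifold is smooth. -/
theorem IsSubmanifold.smooth_val (hN : A.IsSubmanifold N) :
    hN.atlas.Smooth A (Subtype.val : N → X) := by
  refine SmoothOn.of_local isOpen_univ fun x _ => ?_
  obtain ⟨c, hc, hx, F, h⟩ := hN x x.2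
  have hc' := isChart_restrict hN hc h x
  refine ⟨(c.restrict h x).homeo.source, (c.restrict h x).homeo.open_source, hx, ?_⟩
  have h1 : hN.atlas.SmoothOn (ofModel c.Model) (fun y => ((c.restrictHomeo h x y : F) : c.Model))
      (c.restrict h x).homeo.source :=
    Smooth.comp_smoothOn (smooth_clm F.subtypeL) hc'.smoothOn (c.restrict h x).homeo.open_source
  have h2 : ∀ y ∈ (c.restrict h x).homeo.source, ((c.restrictHomeo h x y : F) : c.Model) =
      c.homeo y := fun y hy => h.restrict_apply x hy
  refine (SmoothOn.comp hc.smoothOn_symm h1 (c.restrict h x).homeo.open_source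
    c.homeo.open_target fun y hy => ?_).congr (c.restrict h x).homeo.open_source fun y hy => ?_
  · rw [h2 y hy]; exact c.homeo.map_source hy
  · exact ((congrArg c.homeo.symm (h2 y hy)).trans (c.homeo.left_inv hy)).symm

/-- A map into a submanifold is smooth if it is smooth as a map to the ambient manifold. -/
theorem IsSubmanifold.smoothOn_of_val (hN : A.IsSubmanifold N) {f : Y → N} {U : Set Y}
    (hU : IsOpen U) (hf : B.SmoothOn A (fun y => (f y : X)) U) : B.SmoothOn hN.atlas f U := by
  have hcont : ContinuousOn f U := IsInducing.subtypeVal.continuousOn_iff.2 hf.1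
  refine ⟨hcont, ?_⟩
  rintro b hb _ ⟨c, F, h, x₀, hc, rfl⟩ n
  have hop := b.isOpen_overlap
    (hcont.isOpen_inter_preimage hU (c.restrict h x₀).homeo.open_source)
  refine CnOn.of_subtype (P := F) (f := fun y => c.restrictHomeo h x₀ (f (b.homeo.symm y)))
    h.isClosed hop ?_
  have h1 : B.SmoothOn (ofModel c.Model) (fun y => c.homeo (f y : X))
      (U ∩ f ⁻¹' (c.restrict h x₀).homeo.source) :=
    SmoothOn.comp hc.smoothOn (hf.mono inter_subset_left)
      (hcont.isOpen_inter_preimage hU (c.restrict h x₀).homeo.open_source) c.homeo.open_source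
      fun y hy => hy.2
  refine ((h1.2 b hb _ rfl n).mono fun y hy => ⟨hy.1, hy.2, mem_univ _⟩).congr hop fun y hy => ?_
  exact h.restrict_apply x₀ hy.2.2

end Submanifold

end SmoothAtlas

/-! ### Compact Lie subgroups -/

section StrictDerivative

variable {E : Type v} {F : Type w} [NormedAddCommGroup E] [NormedSpace ℝ E]
  [NormedAddCommGroup F] [NormedSpace ℝ F]

instance LCSpace.instNormed : LCSpace E where

theorem dirDeriv_smul {f : E → F} {x v : E} {t : ℝ} {y z : F}
    (hy : Tendsto (fun s : ℝ => s⁻¹ • (f (x + s • v) - f x)) (𝓝[≠] 0) (𝓝 y))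
    (hz : Tendsto (fun s : ℝ => s⁻¹ • (f (x + s • t • v) - f x)) (𝓝[≠] 0) (𝓝 z)) :
    z = t • y := by
  rcases eq_or_ne t 0 with rfl | ht
  · refine tendsto_nhds_unique hz ?_
    simp
  · have hlim : Tendsto (fun s : ℝ => s * t) (𝓝[≠] 0) (𝓝[≠] 0) := by
      refine tendsto_nhdsWithin_iff.2 ⟨?_, ?_⟩
      · have : Tendsto (fun s : ℝ => s * t) (𝓝 0) (𝓝 (0 * t)) :=
          (continuous_id.mul continuous_const).tendsto 0
        rw [zero_mul] at this
        exact this.mono_left nhdsWithin_le_nhds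
      · filter_upwards [self_mem_nhdsWithin] with s hs
        exact mul_ne_zero hs ht
    refine tendsto_nhds_unique hz (((hy.comp hlim).const_smul t).congr fun s => ?_)
    simp only [Function.comp_apply, smul_smul, mul_inv_rev, ← mul_assoc, mul_inv_cancel₀ ht,
      one_mul]

theorem eventually_norm_sub_dirDeriv_le [FiniteDimensional ℝ E] {f : E → F} {df : E × E → F}
    {U : Set E} (hU : IsOpen U)
    (hdf : ∀ x ∈ U, ∀ v, Tendsto (fun t : ℝ => t⁻¹ • (f (x + t • v) - f x)) (𝓝[≠] 0)
      (𝓝 (df (x, v))))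
    (hc : ContinuousOn df (U ×ˢ univ)) {x : E} (hx : x ∈ U) {ε : ℝ} (hε : 0 < ε) :
    ∀ᶠ p : E × E in 𝓝 (x, x), ‖f p.1 - f p.2 - df (x, p.1 - p.2)‖ ≤ ε * ‖p.1 - p.2‖ := by
  have hsmul : ∀ z ∈ U, ∀ (t : ℝ) v, df (z, t • v) = t • df (z, v) := fun z hz t v =>
    dirDeriv_smul (hdf z hz v) (hdf z hz (t • v))
  have hopen : IsOpen (U ×ˢ (univ : Set E)) := hU.prod isOpen_univ
  have key : ∀ᶠ z in 𝓝 x, ∀ u ∈ Metric.sphere (0 : E) 1, z ∈ U ∧ ‖df (z, u) - df (x, u)‖ ≤ ε := by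
    refine (isCompact_sphere (0 : E) 1).eventually_forall_of_forall_eventually fun u _ => ?_
    have h1 : ContinuousAt df (x, u) := hc.continuousAt (hopen.mem_nhds ⟨hx, mem_univ _⟩)
    have h2 : ContinuousAt (fun p : E × E => df (x, p.2)) (x, u) :=
      ContinuousAt.comp (f := fun p : E × E => (x, p.2)) h1 (by fun_prop)
    have h3 : ContinuousAt (fun p : E × E => ‖df p - df (x, p.2)‖) (x, u) := (h1.sub h2).norm
    have h4 : ∀ᶠ p in 𝓝 (x, u), ‖df p - df (x, p.2)‖ < ε := by
      refine h3.eventually_lt continuousAt_const ?_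
      simpa using hε
    filter_upwards [h4, hopen.mem_nhds (show (x, u) ∈ U ×ˢ univ from ⟨hx, mem_univ _⟩)]
      with p hp hpU
    exact ⟨hpU.1, hp.le⟩
  obtain ⟨δ, hδ, hball⟩ := Metric.eventually_nhds_iff_ball.1 key
  have hmem : Metric.ball x δ ×ˢ Metric.ball x δ ∈ 𝓝 (x, x) :=
    prod_mem_nhds (Metric.ball_mem_nhds x hδ) (Metric.ball_mem_nhds x hδ)
  filter_upwards [hmem] with p hp
  obtain ⟨a, b⟩ := p
  rcases eq_or_ne a b with rfl | hab
  · have h0 : df (x, (0 : E)) = 0 := by simpa using hsmul x hx 0 0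
    simp [h0]
  have hn : 0 < ‖a - b‖ := norm_pos_iff.2 (sub_ne_zero.2 hab)
  set u := ‖a - b‖⁻¹ • (a - b) with hu
  have hus : u ∈ Metric.sphere (0 : E) 1 := by
    rw [mem_sphere_zero_iff_norm, hu, norm_smul, norm_inv, norm_norm, inv_mul_cancel₀ hn.ne']
  have hab' : a - b = ‖a - b‖ • u := by rw [hu, smul_smul, mul_inv_cancel₀ hn.ne', one_smul]
  have hseg : ∀ s ∈ uIcc (0 : ℝ) 1, b + s • (a - b) ∈ Metric.ball x δ := by
    intro s hs
    rw [uIcc_of_le zero_le_one] at hs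
    exact (convex_ball x δ).add_smul_sub_mem hp.2 hp.1 hs
  have := slope_mem_of_lineDeriv (g := fun s : ℝ => f (b + s • (a - b)))
    (g' := fun s => df (b + s • (a - b), a - b)) (t := 1) one_ne_zero
    (Metric.isClosed_closedBall (x := df (x, a - b)) (ε := ε * ‖a - b‖)) (convex_closedBall _ _)
    (fun s hs => by
      refine (hdf _ (hball _ (hseg s hs) u hus).1 (a - b)).congr fun h => ?_
      simp only [add_smul, add_assoc])
    (fun s hs => by
      obtain ⟨hz, hz'⟩ := hball _ (hseg s hs) u hus
      have he : df (b + s • (a - b), a - b) - df (x, a - b) =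
          ‖a - b‖ • (df (b + s • (a - b), u) - df (x, u)) := by
        rw [smul_sub ‖a - b‖ (df _), ← hsmul _ hz, ← hsmul _ hx, ← hab']
      rw [mem_closedBall_iff_norm, he, norm_smul, norm_norm, mul_comm]
      exact mul_le_mul_of_nonneg_right hz' hn.le)
  rw [mem_closedBall_iff_norm] at this
  simpa only [inv_one, one_smul, zero_smul, add_zero, add_sub_cancel] using this

theorem hasStrictFDerivAt_of_dirDeriv [FiniteDimensional ℝ E] {f : E → F} {df : E × E → F}
    {U : Set E} (hU : IsOpen U)
    (hdf : ∀ x ∈ U, ∀ v, Tendsto (fun t : ℝ => t⁻¹ • (f (x + t • v) - f x)) (𝓝[≠] 0)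
      (𝓝 (df (x, v))))
    (hc : ContinuousOn df (U ×ˢ univ)) {x : E} (hx : x ∈ U) :
    ∃ L : E →L[ℝ] F, (∀ v, L v = df (x, v)) ∧ HasStrictFDerivAt f L x := by
  have hsmul : ∀ (t : ℝ) v, df (x, t • v) = t • df (x, v) := fun t v =>
    dirDeriv_smul (hdf x hx v) (hdf x hx (t • v))
  have hadd : ∀ v w, df (x, v + w) = df (x, v) + df (x, w) := by
    intro v w
    have hr : Tendsto (fun t : ℝ => t⁻¹ • (f (x + t • (v + w)) - f (x + t • v))) (𝓝[≠] 0)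
        (𝓝 (df (x, w))) := by
      rw [Metric.tendsto_nhds]
      intro ε hε
      have hpos : 0 < ‖w‖ + 1 := by positivity
      have hlim : Tendsto (fun t : ℝ => (x + t • (v + w), x + t • v)) (𝓝[≠] 0) (𝓝 (x, x)) :=
        (tendsto_line x (v + w)).prodMk_nhds (tendsto_line x v)
      filter_upwards [hlim.eventually (eventually_norm_sub_dirDeriv_le hU hdf hc hx
        (div_pos hε hpos)), self_mem_nhdsWithin] with t ht ht0
      have ht0 : t ≠ 0 := ht0
      have hw : x + t • (v + w) - (x + t • v) = t • w := by module
      rw [hw, hsmul, norm_smul] at ht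
      have he : t⁻¹ • (f (x + t • (v + w)) - f (x + t • v)) - df (x, w) =
          t⁻¹ • (f (x + t • (v + w)) - f (x + t • v) - t • df (x, w)) := by
        rw [smul_sub _ _ (t • df (x, w)), smul_smul, inv_mul_cancel₀ ht0, one_smul]
      have habs : 0 < ‖t‖ := norm_pos_iff.2 ht0
      rw [dist_eq_norm, he, norm_smul, norm_inv]
      calc ‖t‖⁻¹ * ‖f (x + t • (v + w)) - f (x + t • v) - t • df (x, w)‖
          ≤ ‖t‖⁻¹ * (ε / (‖w‖ + 1) * (‖t‖ * ‖w‖)) := by gcongr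
        _ = ε * (‖w‖ / (‖w‖ + 1)) := by field_simp
        _ < ε * 1 := by
          gcongr
          rw [div_lt_one hpos]
          exact lt_add_one _
        _ = ε := mul_one ε
    refine tendsto_nhds_unique (hdf x hx (v + w)) (((hdf x hx v).add hr).congr fun t => ?_)
    rw [← smul_add]
    congr 1
    abel
  let L : E →ₗ[ℝ] F :=
    { toFun := fun v => df (x, v)
      map_add' := hadd
      map_smul' := hsmul }
  refine ⟨L.toContinuousLinearMap, fun v => rfl, ?_⟩
  refine HasStrictFDerivAt.of_isLittleO ?_
  rw [Asymptotics.isLittleO_iff]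
  intro ε hε
  exact eventually_norm_sub_dirDeriv_le hU hdf hc hx hε

end StrictDerivative

/-- A map between open subsets of a finite-dimensional space with continuous directional
derivatives is open near a point where the derivative is injective. -/
theorem map_nhds_eq_of_dirDeriv_injective {E : Type v} [AddCommGroup E] [Module ℝ E]
    [TopologicalSpace E] [LCSpace E] [FiniteDimensional ℝ E] {f : E → E} {df : E × E → E}
    {U : Set E} (hU : IsOpen U)
    (hdf : ∀ x ∈ U, ∀ v, Tendsto (fun t : ℝ => t⁻¹ • (f (x + t • v) - f x)) (𝓝[≠] 0)
      (𝓝 (df (x, v))))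
    (hc : ContinuousOn df (U ×ˢ univ)) {x : E} (hx : x ∈ U)
    (hinj : Function.Injective fun v => df (x, v)) : map f (𝓝 x) = 𝓝 (f x) := by
  let e : E ≃L[ℝ] EuclideanSpace ℝ (Fin (Module.finrank ℝ E)) :=
    ContinuousLinearEquiv.ofFinrankEq (by simp)
  have hc' : ContinuousOn (fun p => e (df (e.symm p.1, e.symm p.2))) ((e.symm ⁻¹' U) ×ˢ univ) := by
    refine e.continuous.comp_continuousOn (hc.comp
      (f := fun p : EuclideanSpace ℝ (Fin (Module.finrank ℝ E)) × _ => (e.symm p.1, e.symm p.2))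
      ?_ ?_)
    · fun_prop
    · rintro p ⟨hp, -⟩
      exact ⟨hp, mem_univ _⟩
  obtain ⟨L, hL, hstrict⟩ := hasStrictFDerivAt_of_dirDeriv (f := fun y => e (f (e.symm y)))
    (df := fun p => e (df (e.symm p.1, e.symm p.2))) (x := e x)
    (hU.preimage e.symm.continuous) (fun y hy v => by
      refine ((e.continuous.tendsto _).comp (hdf (e.symm y) hy (e.symm v))).congr fun t => ?_
      simp) hc' (by simpa using hx)
  have hLinj : Function.Injective L := by
    intro v w hvw
    rw [hL, hL] at hvw
    have h1 := e.injective hvw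
    simp only [e.symm_apply_apply] at h1
    exact e.symm.injective (hinj h1)
  let L' : EuclideanSpace ℝ (Fin (Module.finrank ℝ E)) ≃L[ℝ]
      EuclideanSpace ℝ (Fin (Module.finrank ℝ E)) :=
    (LinearEquiv.ofInjectiveEndo L.toLinearMap hLinj).toContinuousLinearEquiv
  have hL' : (L' : EuclideanSpace ℝ (Fin (Module.finrank ℝ E)) →L[ℝ] _) = L := by
    ext1 v
    rfl
  rw [← hL'] at hstrict
  have hmap := hstrict.map_nhds_eq_of_equiv
  have hcomp : f = e.symm ∘ (fun y => e (f (e.symm y))) ∘ e := by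
    ext y
    simp
  have h1 : map e (𝓝 x) = 𝓝 (e x) := e.toHomeomorph.map_nhds_eq x
  have h2 : ∀ y, map e.symm (𝓝 y) = 𝓝 (e.symm y) := e.symm.toHomeomorph.map_nhds_eq
  rw [hcomp, ← Filter.map_map, ← Filter.map_map, h1, hmap, h2]
  rfl

theorem dirDeriv_injective_of_leftInverse {E F : Type*} [AddCommGroup E] [Module ℝ E]
    [TopologicalSpace E] [LCSpace E] [AddCommGroup F] [Module ℝ F]
    [TopologicalSpace F] [LCSpace F] (ι : F →L[ℝ] E) (hι : Function.Injective ι)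
    {f : F → F} {df : F × F → F} {U : Set F} (hU : IsOpen U)
    (hdf : ∀ x ∈ U, ∀ v, Tendsto (fun t : ℝ => t⁻¹ • (f (x + t • v) - f x)) (𝓝[≠] 0)
      (𝓝 (df (x, v))))
    {g : E → E} {dg : E × E → E} {O : Set E} (hO : IsOpen O)
    (hdg : ∀ x ∈ O, ∀ v, Tendsto (fun t : ℝ => t⁻¹ • (g (x + t • v) - g x)) (𝓝[≠] 0)
      (𝓝 (dg (x, v)))) (hdgc : ContinuousOn dg (O ×ˢ univ))
    (hgf : ∀ y ∈ U, ι (f y) ∈ O ∧ g (ι (f y)) = ι y) {x : F} (hx : x ∈ U) :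
    Function.Injective fun v => df (x, v) := by
  have hleft : ∀ v : F, dg (ι (f x), ι (df (x, v))) = ι v := by
    intro v
    have hlim : Tendsto (fun t : ℝ => ι (t⁻¹ • (f (x + t • v) - f x))) (𝓝[≠] 0)
        (𝓝 (ι (df (x, v)))) := (ι.continuous.tendsto _).comp (hdf x hx v)
    refine tendsto_nhds_unique (tendsto_slope_of_dirDeriv hO hdg hdgc (hgf x hx).1 hlim)
      (tendsto_const_nhds.congr' ?_)
    filter_upwards [self_mem_nhdsWithin, tendsto_line x v (hU.mem_nhds hx)] with t ht htU
    have ht : t ≠ 0 := ht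
    have h5 : ι (f x) + t • ι (t⁻¹ • (f (x + t • v) - f x)) = ι (f (x + t • v)) := by
      rw [← map_smul, smul_smul, mul_inv_cancel₀ ht, one_smul, map_sub, add_sub_cancel]
    rw [h5, (hgf _ htU).2, (hgf x hx).2, map_add, add_sub_cancel_left, map_smul, smul_smul,
      inv_mul_cancel₀ ht, one_smul]
  intro v w hvw
  have hvw : df (x, v) = df (x, w) := hvw
  exact hι (by rw [← hleft v, ← hleft w, hvw])

/-- A `C^1` map of a finite-dimensional space `F` is open if it has a `C^1` left inverse on a
space containing `F`. -/
theorem map_nhds_eq_of_leftInverse {E : Type u} {F : Type v} [AddCommGroup E] [Module ℝ E]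
    [TopologicalSpace E] [LCSpace E] [AddCommGroup F] [Module ℝ F] [TopologicalSpace F]
    [LCSpace F] [FiniteDimensional ℝ F] (ι : F →L[ℝ] E) (hι : Function.Injective ι)
    {f : F → F} {U : Set F} (hU : IsOpen U) (hf : CnOn 1 f U)
    {g : E → E} {O : Set E} (hO : IsOpen O) (hg : CnOn 1 g O)
    (hgf : ∀ y ∈ U, ι (f y) ∈ O ∧ g (ι (f y)) = ι y) {x : F} (hx : x ∈ U) :
    map f (𝓝 x) = 𝓝 (f x) := by
  obtain ⟨-, df, hdf, hdfc⟩ := hf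
  obtain ⟨-, dg, hdg, hdgc⟩ := hg
  exact map_nhds_eq_of_dirDeriv_injective hU hdf hdfc.continuousOn hx
    (dirDeriv_injective_of_leftInverse ι hι hU hdf hO hdg hdgc.continuousOn hgf hx)

/-- An injective continuous endomorphism with open range of a compact group with a connected
neighborhood of the unit is surjective. -/
theorem MonoidHom.surjective_of_range_mem_nhds {T : Type*} [Group T] [TopologicalSpace T]
    [IsTopologicalGroup T] [CompactSpace T] [T2Space T] {V : Set T} (hV : V ∈ 𝓝 (1 : T))
    (hVc : IsPreconnected V) (φ : T →* T) (hφ : Continuous φ) (hinj : Function.Injective φ)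
    (hrange : Set.range φ ∈ 𝓝 (1 : T)) : Function.Surjective φ := by
  let L : Subgroup T := Subgroup.closure V
  have hLo : IsOpen (L : Set T) :=
    L.isOpen_of_mem_nhds (g := 1) (mem_of_superset hV (Subgroup.subset_closure (k := V)))
  have hmin : ∀ K : Subgroup T, IsOpen (K : Set T) → L ≤ K := fun K hK =>
    (Subgroup.closure_le K).2 (hVc.subset_isClopen ⟨K.isClosed_of_isOpen hK, hK⟩
      ⟨1, mem_of_mem_nhds hV, K.one_mem⟩)
  have hro : IsOpen (φ.range : Set T) :=
    φ.range.isOpen_of_mem_nhds (g := 1) (by simpa using hrange)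
  have hemb : IsOpenEmbedding φ :=
    ⟨(hφ.isClosedEmbedding hinj).isEmbedding, by simpa using hro⟩
  have hmap : L.map φ = L := by
    refine le_antisymm ?_ (hmin _ ?_)
    · exact Subgroup.map_le_iff_le_comap.2 (hmin _ (hLo.preimage hφ))
    · simpa using hemb.isOpenMap _ hLo
  have hfin : L.FiniteIndex := by
    have := L.quotient_finite_of_isOpen hLo
    exact Subgroup.finiteIndex_of_finite_quotient
  have hrel : L.relIndex φ.range = L.index := by
    conv_lhs => rw [← hmap, MonoidHom.range_eq_map]
    rw [Subgroup.relIndex_map_map_of_injective _ _ hinj, Subgroup.relIndex_top_right]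
  have hmul := Subgroup.relIndex_mul_index (hmin _ hro)
  rw [hrel] at hmul
  have hone : φ.range.index = 1 := by
    have := hfin.index_ne_zero
    exact Nat.eq_of_mul_eq_mul_left (Nat.pos_of_ne_zero this) (by rw [hmul, mul_one])
  exact MonoidHom.range_eq_top.1 (Subgroup.index_eq_one.1 hone)

/-- Around a point of a compact submanifold the charts are modelled on finite-dimensional spaces. -/
theorem LCChart.finiteDimensional_of_compactSpace {X : Type u} [TopologicalSpace X] [T2Space X]
    [CompactSpace X] (c : LCChart X) {x : X} (hx : x ∈ c.homeo.source) :
    FiniteDimensional ℝ c.Model := by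
  obtain ⟨K, hK, hKs, hKc⟩ := local_compact_nhds (c.homeo.open_source.mem_nhds hx)
  have h1 : c.homeo '' K ∈ 𝓝 (c.homeo x) := c.homeo.image_mem_nhds hx hK
  have h2 : IsCompact (c.homeo '' K) := hKc.image_of_continuousOn (c.homeo.continuousOn.mono hKs)
  let : UniformSpace c.Model := IsTopologicalAddGroup.rightUniformSpace c.Model
  have : IsUniformAddGroup c.Model := isUniformAddGroup_of_addCommGroup
  exact FiniteDimensional.of_totallyBounded_nhds ℝ h1 h2.totallyBounded

/-- Every point in the domain of a chart has a connected neighborhood. -/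
theorem LCChart.exists_preconnected_nhds {X : Type u} [TopologicalSpace X] (c : LCChart X) {x : X}
    (hx : x ∈ c.homeo.source) : ∃ V ∈ 𝓝 x, IsPreconnected V := by
  obtain ⟨C, hC, hconv, hCsub⟩ := (locallyConvexSpace_iff_exists_convex_subset ℝ c.Model).1
    inferInstance (c.homeo x) _ (c.homeo.open_target.mem_nhds (c.homeo.map_source hx))
  refine ⟨c.homeo.symm '' C, ?_,
    hconv.isPreconnected.image _ (c.homeo.symm.continuousOn.mono hCsub)⟩
  have := c.homeo.symm.image_mem_nhds (c.homeo.map_source hx) hC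
  rwa [c.homeo.left_inv hx] at this

section LieGroup

variable {G : Type u} [Group G] [TopologicalSpace G] {𝓖 : SmoothAtlas G}

theorem IsLieGroup.isTopologicalGroup (hG : IsLieGroup 𝓖) : IsTopologicalGroup G where
  continuous_mul := hG.smooth_mul.continuous
  continuous_inv := hG.smooth_inv.continuous

theorem IsLieGroup.smooth_conj (hG : IsLieGroup 𝓖) (b : G) :
    𝓖.Smooth 𝓖 fun g => b * g * b⁻¹ := by
  have h1 : 𝓖.Smooth 𝓖 fun g => b * g :=
    SmoothAtlas.Smooth.comp (g := fun p : G × G => p.1 * p.2) (f := fun g => (b, g))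
      hG.smooth_mul (SmoothAtlas.SmoothOn.prodMk (SmoothAtlas.smooth_const 𝓖 𝓖 b) 𝓖.smooth_id)
  exact SmoothAtlas.Smooth.comp (g := fun p : G × G => p.1 * p.2) (f := fun g => (b * g, b⁻¹))
    hG.smooth_mul (SmoothAtlas.SmoothOn.prodMk h1 (SmoothAtlas.smooth_const 𝓖 𝓖 b⁻¹))

/-- If a conjugate of a compact Lie subgroup is contained in the subgroup, then it is open
in it. -/
theorem range_conj_mem_nhds [T2Space G] (hG : IsLieGroup 𝓖) {N : Set G}
    (hN : 𝓖.IsSubmanifold N) (hcomp : IsCompact N) (h1 : (1 : G) ∈ N) {b : G}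
    (φ : N → N) (hφ : ∀ g, (φ g : G) = b * g * b⁻¹) :
    range φ ∈ 𝓝 (⟨1, h1⟩ : N) := by
  obtain ⟨c, hc, hxc, F, hF⟩ := hN 1 h1
  have : CompactSpace N := isCompact_iff_compactSpace.1 hcomp
  obtain ⟨e, he⟩ : ∃ e : N, e = ⟨1, h1⟩ := ⟨_, rfl⟩
  rw [← he]
  obtain ⟨r, hr⟩ : ∃ r, r = c.restrictHomeo hF e := ⟨_, rfl⟩
  have her : e ∈ r.source := by
    rw [hr, he]
    exact hxc
  have : FiniteDimensional ℝ F := (c.restrict hF e).finiteDimensional_of_compactSpace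
    (by rwa [hr] at her)
  have hφe : φ e = e := Subtype.ext (by rw [hφ, he]; simp)
  have hφs : hN.atlas.Smooth hN.atlas φ := by
    refine hN.smoothOn_of_val isOpen_univ ?_
    simp only [hφ]
    exact SmoothAtlas.Smooth.comp (hG.smooth_conj b) hN.smooth_val
  have hmem : c.restrict hF e ∈ hN.atlas.charts := ⟨c, F, hF, e, hc, rfl⟩
  have hf : CnOn 1 (fun y : F => r (φ (r.symm y)))
      (r.target ∩ r.symm ⁻¹' (univ ∩ φ ⁻¹' r.source)) := by
    rw [hr]
    exact hφs.2 _ hmem _ hmem 1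
  have hU : IsOpen (r.target ∩ r.symm ⁻¹' (univ ∩ φ ⁻¹' r.source)) :=
    r.isOpen_inter_preimage_symm (hφs.isOpen_inter_preimage isOpen_univ r.open_source)
  have hψ := (SmoothAtlas.isChart_iff.1 hc)
  have hO : IsOpen (c.homeo.target ∩ c.homeo.symm ⁻¹'
      (univ ∩ (fun g => b⁻¹ * g * b⁻¹⁻¹) ⁻¹' c.homeo.source)) :=
    c.isOpen_overlap ((hG.smooth_conj b⁻¹).isOpen_inter_preimage isOpen_univ c.homeo.open_source)
  have hg : CnOn 1 (fun y : c.Model => c.homeo (b⁻¹ * c.homeo.symm y * b⁻¹⁻¹))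
      (c.homeo.target ∩ c.homeo.symm ⁻¹'
        (univ ∩ (fun g => b⁻¹ * g * b⁻¹⁻¹) ⁻¹' c.homeo.source)) := by
    have h2 := SmoothAtlas.SmoothOn.comp hψ.1 ((hG.smooth_conj b⁻¹).smoothOn
      (univ ∩ (fun g => b⁻¹ * g * b⁻¹⁻¹) ⁻¹' c.homeo.source))
      ((hG.smooth_conj b⁻¹).isOpen_inter_preimage isOpen_univ c.homeo.open_source)
      c.homeo.open_source (fun g hg => hg.2)
    have h3 := SmoothAtlas.SmoothOn.comp h2 (hψ.2.mono inter_subset_left) hO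
      ((hG.smooth_conj b⁻¹).isOpen_inter_preimage isOpen_univ c.homeo.open_source)
      (fun y hy => hy.2)
    exact SmoothAtlas.smoothOn_ofModel_iff.1 h3 1
  obtain ⟨U, hUdef⟩ : ∃ U, U = r.target ∩ r.symm ⁻¹' (univ ∩ φ ⁻¹' r.source) := ⟨_, rfl⟩
  obtain ⟨O, hOdef⟩ : ∃ O, O = c.homeo.target ∩ c.homeo.symm ⁻¹'
    (univ ∩ (fun g => b⁻¹ * g * b⁻¹⁻¹) ⁻¹' c.homeo.source) := ⟨_, rfl⟩
  rw [← hUdef] at hf hU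
  rw [← hOdef] at hg hO
  have hyU : r e ∈ U := by
    rw [hUdef]
    refine ⟨r.map_source her, mem_univ _, ?_⟩
    rw [mem_preimage, r.left_inv her, hφe]
    exact her
  have hfe : r (φ (r.symm (r e))) = r e := by rw [r.left_inv her, hφe]
  have hval : ∀ n : N, n ∈ r.source → ((r n : F) : c.Model) = c.homeo n :=
    fun n hn => by
      rw [hr] at hn ⊢
      exact hF.restrict_apply e hn
  have hrs : ∀ n : N, n ∈ r.source ↔ (n : G) ∈ c.homeo.source := fun n => by rw [hr]; rfl
  have hgf : ∀ y ∈ U, ((r (φ (r.symm y)) : F) : c.Model) ∈ O ∧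
      c.homeo (b⁻¹ * c.homeo.symm ((r (φ (r.symm y)) : F) : c.Model) * b⁻¹⁻¹) = y := by
    intro y hyU
    rw [hUdef] at hyU
    obtain ⟨hy, -, hy'⟩ := hyU
    have hy' : φ (r.symm y) ∈ r.source := hy'
    have hys : r.symm y ∈ r.source := r.map_target hy
    have h3 : b⁻¹ * c.homeo.symm (c.homeo (φ (r.symm y))) * b⁻¹⁻¹ = r.symm y := by
      rw [c.homeo.left_inv ((hrs _).1 hy'), hφ]
      group
    rw [hval _ hy', h3, ← hval _ hys, r.right_inv hy]
    refine ⟨?_, rfl⟩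
    rw [hOdef]
    refine ⟨c.homeo.map_source ((hrs _).1 hy'), mem_univ _, ?_⟩
    rw [mem_preimage, h3]
    exact (hrs _).1 hys
  have hmap := map_nhds_eq_of_leftInverse F.subtypeL Subtype.val_injective hU hf hO hg hgf hyU
  rw [hfe] at hmap
  have himg : (fun y : F => r (φ (r.symm y))) '' U ∈ 𝓝 (r e) := by
    rw [← hmap]
    exact image_mem_map (hU.mem_nhds hyU)
  filter_upwards [(r.continuousAt her).preimage_mem_nhds himg, r.open_source.mem_nhds her]
    with n hn hns
  obtain ⟨y, hy, hyn⟩ := hn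
  rw [hUdef] at hy
  exact ⟨r.symm y, r.injOn hy.2.2 hns hyn⟩

/-- A compact Lie subgroup is not conjugate to a proper subgroup of itself. -/
theorem map_conj_eq_of_le [T2Space G] (hG : IsLieGroup 𝓖) {H : Subgroup G}
    (hH : 𝓖.IsSubmanifold (H : Set G)) (hcomp : IsCompact (H : Set G)) {b : G}
    (hb : H.map (MulAut.conj b).toMonoidHom ≤ H) : H.map (MulAut.conj b).toMonoidHom = H := by
  have := hG.isTopologicalGroup
  have : CompactSpace H := isCompact_iff_compactSpace.1 hcomp
  let φ : H →* H := ((MulAut.conj b).toMonoidHom.comp H.subtype).codRestrict H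
    fun h => hb ⟨h, h.2, rfl⟩
  have hφ : ∀ h, (φ h : G) = b * h * b⁻¹ := fun h => rfl
  obtain ⟨c, hc, hxc, F, hF⟩ := hH 1 H.one_mem
  obtain ⟨V, hV, hVc⟩ := (c.restrict hF ⟨1, H.one_mem⟩).exists_preconnected_nhds
    (x := (⟨1, H.one_mem⟩ : (H : Set G))) hxc
  have hsurj : Function.Surjective φ := by
    refine MonoidHom.surjective_of_range_mem_nhds (T := H) (V := V) hV hVc φ ?_ ?_ ?_
    · refine continuous_induced_rng.2 ?_
      exact (continuous_const.mul continuous_subtype_val).mul continuous_const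
    · intro h k hhk
      have := congrArg (Subtype.val : H → G) hhk
      rw [hφ, hφ] at this
      exact Subtype.ext (mul_left_cancel (mul_right_cancel this))
    · exact range_conj_mem_nhds hG hH hcomp H.one_mem φ hφ
  refine le_antisymm hb fun h hh => ?_
  obtain ⟨k, hk⟩ := hsurj ⟨h, hh⟩
  exact ⟨k, k.2, congrArg Subtype.val hk⟩

end LieGroup

/-! ### Quotient manifolds -/

namespace SmoothAtlas

variable {X P : Type u} [TopologicalSpace X] [TopologicalSpace P] {A : SmoothAtlas X} {p : X → P}

/-- A chart `d` of the quotient `P` of `X` in which `p` is smooth and has smooth local sections. -/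
structure IsQuotientChart (A : SmoothAtlas X) (p : X → P) (d : LCChart P) : Prop where
  smoothOn : A.SmoothOn (ofModel d.Model) (fun x => d.homeo (p x)) (p ⁻¹' d.homeo.source)
  exists_section : ∀ y ∈ d.homeo.source, ∃ (V : Set d.Model) (σ : d.Model → X), IsOpen V ∧
    d.homeo y ∈ V ∧ V ⊆ d.homeo.target ∧ (ofModel d.Model).SmoothOn A σ V ∧
    ∀ z ∈ V, p (σ z) = d.homeo.symm z

theorem IsQuotientChart.smoothTo {d e : LCChart P} (hp : Continuous p)
    (hd : A.IsQuotientChart p d) (he : A.IsQuotientChart p e) : d.SmoothTo e := by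
  refine smoothTo_of_smoothOn (SmoothOn.of_local (d.isOpen_overlap e.homeo.open_source) ?_)
  rintro z ⟨hz, hze⟩
  obtain ⟨V, σ, hV, hzV, hVd, hσ, hpσ⟩ := hd.exists_section _ (d.homeo.map_target hz)
  rw [d.homeo.right_inv hz] at hzV
  have hopen : IsOpen (p ⁻¹' e.homeo.source) := e.homeo.open_source.preimage hp
  have hW := hσ.isOpen_inter_preimage hV hopen
  refine ⟨_, hW, ⟨hzV, ?_⟩, ?_⟩
  · rw [mem_preimage, mem_preimage, hpσ z hzV]
    exact hze
  · refine (SmoothOn.comp he.smoothOn (hσ.mono inter_subset_left) hW hopen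
      fun y hy => hy.2).congr hW fun y hy => ?_
    simp only [hpσ y hy.1]

/-- The atlas of all quotient charts. -/
def quotientAtlas (A : SmoothAtlas X) {p : X → P} (hp : Continuous p)
    (hcover : ∀ y, ∃ d, A.IsQuotientChart p d ∧ y ∈ d.homeo.source) : SmoothAtlas P where
  charts := {d | A.IsQuotientChart p d}
  cover := hcover
  compatible := fun _ hc _ hd => hc.smoothTo hp hd

theorem smooth_quotientAtlas (hp : Continuous p)
    (hcover : ∀ y, ∃ d, A.IsQuotientChart p d ∧ y ∈ d.homeo.source) :
    A.Smooth (A.quotientAtlas hp hcover) p :=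
  ⟨hp.continuousOn, fun c hc _ hd n =>
    ((IsQuotientChart.smoothOn hd).2 c hc _ rfl n).mono fun _ hy => ⟨hy.1, hy.2.2, mem_univ _⟩⟩

/-- If `p` is a smooth submersion, then it is smooth and has smooth local sections in every
chart. -/
theorem IsSubmersion.isQuotientChart {B : SmoothAtlas P} (h : A.IsSubmersion B p)
    (hsurj : Function.Surjective p) {d : LCChart P} (hd : B.IsChart d) :
    A.IsQuotientChart p d := by
  have hp : Continuous p := h.1.continuous
  have hopen : IsOpen (p ⁻¹' d.homeo.source) := d.homeo.open_source.preimage hp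
  refine ⟨SmoothOn.comp hd.smoothOn (h.1.smoothOn _) hopen d.homeo.open_source
    fun x hx => hx, ?_⟩
  intro y hy
  obtain ⟨x, rfl⟩ := hsurj y
  obtain ⟨c, e, hc, he, hxc, hmaps, q, s, hqs, hq⟩ := h.2 x
  -- the section in the charts `c` and `e`
  have h1 : (ofModel d.Model).SmoothOn (ofModel e.Model) (fun z => e.homeo (d.homeo.symm z))
      (d.homeo.target ∩ d.homeo.symm ⁻¹' e.homeo.source) :=
    smoothOn_ofModel_iff.2 (hd.smoothTo he)
  have hO := d.isOpen_overlap e.homeo.open_source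
  let τ : e.Model → c.Model := fun w => c.homeo x + s (w - e.homeo (p x))
  have hτ : (ofModel e.Model).Smooth (ofModel c.Model) τ := by
    have h2 : (ofModel e.Model).Smooth (ofModel c.Model)
        fun w => (c.homeo x - s (e.homeo (p x))) + s w :=
      Smooth.comp (g := fun r : c.Model × c.Model => r.1 + r.2) smooth_add
        (SmoothOn.prodMk (smooth_const _ (ofModel c.Model) _) (smooth_clm s))
    refine SmoothOn.congr h2 isOpen_univ fun w _ => ?_
    simp only [τ, map_sub]
    abel
  have h3 : (ofModel d.Model).SmoothOn (ofModel c.Model) (fun z => τ (e.homeo (d.homeo.symm z)))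
      (d.homeo.target ∩ d.homeo.symm ⁻¹' e.homeo.source) := hτ.comp_smoothOn h1 hO
  have hW := h3.isOpen_inter_preimage hO c.homeo.open_target
  have hpx : p x ∈ e.homeo.source := hmaps hxc
  have hτx : τ (e.homeo (p x)) = c.homeo x := by simp [τ]
  refine ⟨_, fun z => c.homeo.symm (τ (e.homeo (d.homeo.symm z))), hW,
    ⟨⟨d.homeo.map_source hy, ?_⟩, ?_⟩, fun z hz => hz.1.1, ?_, ?_⟩
  · rw [mem_preimage, d.homeo.left_inv hy]
    exact hpx
  · rw [mem_preimage, d.homeo.left_inv hy, hτx]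
    exact c.homeo.map_source hxc
  · exact SmoothOn.comp hc.smoothOn_symm (h3.mono inter_subset_left) hW c.homeo.open_target
      fun z hz => hz.2
  · rintro z ⟨⟨hzd, hze⟩, hzc⟩
    have hmem := c.homeo.map_target hzc
    refine e.homeo.injOn (hmaps hmem) hze ?_
    rw [hq _ hmem, c.homeo.right_inv hzc]
    have hqx := hq x hxc
    simp only [τ, map_add, map_sub, hqs, hqx]
    abel

/-- The manifold structure for which `p` is a submersion is unique. -/
theorem IsSubmersion.equivalent_quotientAtlas {B : SmoothAtlas P} (h : A.IsSubmersion B p)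
    (hsurj : Function.Surjective p) (hp : Continuous p)
    (hcover : ∀ y, ∃ d, A.IsQuotientChart p d ∧ y ∈ d.homeo.source) :
    B.Equivalent (A.quotientAtlas hp hcover) := by
  have hmem : ∀ {d}, B.IsChart d → d ∈ (A.quotientAtlas hp hcover).charts :=
    fun hd => h.isQuotientChart hsurj hd
  intro c
  refine ⟨fun hc => isChart_of_mem (hmem hc), fun hc d hd => hc d (hmem (isChart_of_mem hd))⟩

end SmoothAtlas

/-! ### Orbit types and slices -/

section OrbitTypes

variable {G M : Type u} [Group G] [MulAction G M]

theorem mem_conjClass_self (H : Subgroup G) : H ∈ conjClass H := by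
  refine ⟨1, ?_⟩
  ext g
  simp

theorem map_conj_mul (a b : G) (H : Subgroup G) :
    (H.map (MulAut.conj b).toMonoidHom).map (MulAut.conj a).toMonoidHom =
      H.map (MulAut.conj (a * b)).toMonoidHom := by
  rw [Subgroup.map_map, map_mul]
  rfl

theorem conjClass_map (a : G) (H : Subgroup G) :
    conjClass (H.map (MulAut.conj a).toMonoidHom) = conjClass H := by
  ext K
  constructor
  · rintro ⟨b, rfl⟩
    exact ⟨b * a, map_conj_mul b a H⟩
  · rintro ⟨b, rfl⟩
    refine ⟨b * a⁻¹, ?_⟩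
    rw [map_conj_mul, inv_mul_cancel_right]

theorem conjClass_eq_iff {H K : Subgroup G} : conjClass H = conjClass K ↔ H ∈ conjClass K := by
  refine ⟨fun h => h ▸ mem_conjClass_self H, ?_⟩
  rintro ⟨a, rfl⟩
  exact conjClass_map a K

theorem orbitType_smul (g : G) (m : M) : orbitType G (g • m) = orbitType G m := by
  unfold orbitType
  rw [MulAction.stabilizer_smul_eq_stabilizer_map_conj]
  exact conjClass_map g _

theorem IsSubconjugate.trans {H K L : Subgroup G} (h : IsSubconjugate H K)
    (h' : IsSubconjugate K L) : IsSubconjugate H L := by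
  obtain ⟨a, ha⟩ := h
  obtain ⟨b, hb⟩ := h'
  refine ⟨b * a, ?_⟩
  rw [← map_conj_mul]
  exact (Subgroup.map_mono ha).trans hb

theorem IsSubconjugate.of_orbitType_eq {x y : M} (h : orbitType G x = orbitType G y) :
    IsSubconjugate (MulAction.stabilizer G x) (MulAction.stabilizer G y) := by
  obtain ⟨a, ha⟩ := conjClass_eq_iff.1 h.symm
  exact ⟨a, ha.ge⟩

theorem orbitTypeSubset_isInvariant {τ : Set (Subgroup G)} {x y : M}
    (h : Quotient.mk (MulAction.orbitRel G M) x = Quotient.mk _ y)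
    (hy : y ∈ orbitTypeSubset G M τ) : x ∈ orbitTypeSubset G M τ := by
  obtain ⟨g, hg⟩ := Quotient.exact h
  have hg : g • y = x := hg
  change orbitType G x = τ
  rw [← hg, orbitType_smul]
  exact hy

theorem mk_mem_orbitSpacePiece {τ : Set (Subgroup G)} {x : M} :
    Quotient.mk (MulAction.orbitRel G M) x ∈ orbitSpacePiece G M τ ↔
      x ∈ orbitTypeSubset G M τ := by
  refine ⟨?_, fun h => mem_image_of_mem _ h⟩
  rintro ⟨y, hy, hyx⟩
  exact orbitTypeSubset_isInvariant hyx.symm hy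

theorem pieceProj_surjective (τ : Set (Subgroup G)) :
    Function.Surjective (pieceProj G M τ) := by
  rintro ⟨_, x, hx, rfl⟩
  exact ⟨⟨x, hx⟩, rfl⟩

theorem pieceProj_smul {τ : Set (Subgroup G)} {x y : orbitTypeSubset G M τ} (g : G)
    (h : (y : M) = g • (x : M)) : pieceProj G M τ y = pieceProj G M τ x := by
  refine Subtype.ext (Quotient.sound ?_)
  exact ⟨g, h.symm⟩

theorem exists_smul_of_pieceProj_eq {τ : Set (Subgroup G)} {x y : orbitTypeSubset G M τ}
    (h : pieceProj G M τ x = pieceProj G M τ y) : ∃ g : G, g • (x : M) = y := by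
  have h1 : Quotient.mk (MulAction.orbitRel G M) (y : M) = Quotient.mk _ (x : M) :=
    (congrArg Subtype.val h).symm
  exact Quotient.exact h1

variable [TopologicalSpace M]

theorem continuous_pieceProj (τ : Set (Subgroup G)) : Continuous (pieceProj G M τ) :=
  continuous_induced_rng.2 (continuous_quotient_mk'.comp continuous_subtype_val)

variable [ContinuousConstSMul G M]

theorem mk_mem_closure_orbitSpacePiece {τ : Set (Subgroup G)} {x : M} :
    Quotient.mk (MulAction.orbitRel G M) x ∈ closure (orbitSpacePiece G M τ) ↔
      x ∈ closure (orbitTypeSubset G M τ) := by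
  have h := (isOpenMap_quotient_mk'_mul (Γ := G) (T := M)).preimage_closure_eq_closure_preimage
    continuous_quotient_mk' (orbitSpacePiece G M τ)
  have h2 : Quotient.mk (MulAction.orbitRel G M) ⁻¹' orbitSpacePiece G M τ =
      orbitTypeSubset G M τ := by
    ext y
    exact mk_mem_orbitSpacePiece
  rw [← h2]
  exact Set.ext_iff.1 h x

theorem isOpenMap_pieceProj (τ : Set (Subgroup G)) : IsOpenMap (pieceProj G M τ) := by
  rintro _ ⟨V, hV, rfl⟩
  refine ⟨Quotient.mk (MulAction.orbitRel G M) '' V,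
    isOpenMap_quotient_mk'_mul (Γ := G) (T := M) V hV, ?_⟩
  ext y
  constructor
  · rintro ⟨v, hv, hvy⟩
    have hvτ : v ∈ orbitTypeSubset G M τ := by
      rw [← mk_mem_orbitSpacePiece, hvy]
      exact y.2
    exact ⟨⟨v, hvτ⟩, hv, Subtype.ext hvy⟩
  · rintro ⟨x, hx, rfl⟩
    exact ⟨x, hx, rfl⟩

end OrbitTypes

/-- A product neighborhood `Base × S` of the slice `S` at `m`, in which the slices `{q} × S` are
translates of `S`. -/
structure SliceTube (G : Type u) {M : Type u} [Group G] [TopologicalSpace M] [MulAction G M]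
    (𝓜 : SmoothAtlas M) (m : M) {S : Set M} (hS : 𝓜.IsSubmanifold S) where
  Base : Type u
  [instTopologicalSpace : TopologicalSpace Base]
  atlas : SmoothAtlas Base
  domain : Set Base
  center : Base
  homeo : OpenPartialHomeomorph (Base × S) M
  center_mem : center ∈ domain
  source_eq : homeo.source = domain ×ˢ univ
  exists_smul : ∀ q ∈ domain, ∃ g : G, ∀ s : S, homeo (q, s) = g • (s : M)
  center_smul : ∃ h ∈ MulAction.stabilizer G m, ∀ s : S, homeo (center, s) = h • (s : M)
  isDiffeo : (atlas.prod hS.atlas).IsDiffeo 𝓜 homeo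

attribute [instance] SliceTube.instTopologicalSpace

section Tubes

variable {G M : Type u} [Group G] [TopologicalSpace M] [MulAction G M]
  {𝓜 : SmoothAtlas M} {m : M} {S : Set M}

namespace SliceTube

variable {hS : 𝓜.IsSubmanifold S} (T : SliceTube G 𝓜 m hS)

theorem symm_mem {x : M} (hx : x ∈ T.homeo.target) :
    (T.homeo.symm x).1 ∈ T.domain := by
  have := T.homeo.map_target hx
  rw [T.source_eq] at this
  exact this.1

theorem eq_smul {x : M} (hx : x ∈ T.homeo.target) :
    ∃ g : G, x = g • ((T.homeo.symm x).2 : M) := by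
  obtain ⟨g, hg⟩ := T.exists_smul _ (T.symm_mem hx)
  refine ⟨g, ?_⟩
  rw [← hg]
  exact (T.homeo.right_inv hx).symm

theorem orbitType_eq {x : M} (hx : x ∈ T.homeo.target) :
    orbitType G x = orbitType G ((T.homeo.symm x).2 : M) := by
  obtain ⟨g, hg⟩ := T.eq_smul hx
  conv_lhs => rw [hg]
  exact orbitType_smul g _

theorem center_source (s : S) : (T.center, s) ∈ T.homeo.source := by
  rw [T.source_eq]
  exact ⟨T.center_mem, mem_univ _⟩

theorem apply_center {s : S} (hs : MulAction.stabilizer G (s : M) = MulAction.stabilizer G m) :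
    T.homeo (T.center, s) = s := by
  obtain ⟨h, hh, hs'⟩ := T.center_smul
  rw [hs']
  rw [← hs] at hh
  exact hh

theorem mem_target {s : S} (hs : MulAction.stabilizer G (s : M) = MulAction.stabilizer G m) :
    (s : M) ∈ T.homeo.target := by
  rw [← T.apply_center hs]
  exact T.homeo.map_source (T.center_source s)

theorem symm_apply {s : S} (hs : MulAction.stabilizer G (s : M) = MulAction.stabilizer G m) :
    T.homeo.symm (s : M) = (T.center, s) := by
  conv_lhs => rw [← T.apply_center hs]
  exact T.homeo.left_inv (T.center_source s)

/-- Near a slice, the set of points of the orbit type of the slice is closed. -/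
theorem mem_of_mem_closure (hclosed : IsClosed {s : S | orbitType G (s : M) = orbitType G m})
    {x : M} (hx : x ∈ T.homeo.target) (hcl : x ∈ closure (orbitTypeSubset G M (orbitType G m))) :
    x ∈ orbitTypeSubset G M (orbitType G m) := by
  change orbitType G x = _
  rw [T.orbitType_eq hx]
  have hlim : Tendsto (fun y => (T.homeo.symm y).2) (𝓝 x) (𝓝 (T.homeo.symm x).2) :=
    (continuous_snd.tendsto _).comp (T.homeo.symm.continuousAt hx)
  refine hclosed.mem_of_frequently_of_tendsto ?_ hlim
  refine ((mem_closure_iff_frequently.1 hcl).and_eventually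
    (T.homeo.open_target.mem_nhds hx)).mono ?_
  rintro y ⟨hy, hyt⟩
  have hy : orbitType G y = orbitType G m := hy
  exact (T.orbitType_eq hyt).symm.trans hy

end SliceTube

end Tubes

section Slices

variable {G M : Type u} [Group G] [TopologicalSpace G] [TopologicalSpace M] [MulAction G M]
  {𝓖 : SmoothAtlas G} {𝓜 : SmoothAtlas M} {m : M} {S : Set M}

theorem IsSlice.nonempty_tube (h : IsSlice 𝓖 𝓜 m S) :
    Nonempty (SliceTube G 𝓜 m h.submanifold) := by
  obtain ⟨hH, 𝓠, -, U, χ, ψ, -, hqU, -, hχ, hsource, -, hψ, hdiffeo⟩ := h.locally_product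
  refine ⟨⟨_, 𝓠, U, ((1 : G) : G ⧸ MulAction.stabilizer G m), ψ, hqU, hsource,
    fun q hq => ⟨χ q, hψ q hq⟩, ⟨χ ((1 : G) : G ⧸ MulAction.stabilizer G m), ?_, hψ _ hqU⟩,
    hdiffeo⟩⟩
  have := QuotientGroup.eq.1 (hχ _ hqU).symm
  simpa using this

theorem IsSlice.stabilizer_le (h : IsSlice 𝓖 𝓜 m S) {s : M} (hs : s ∈ S) :
    MulAction.stabilizer G s ≤ MulAction.stabilizer G m := fun g hg =>
  h.mem_stabilizer g ⟨s, hs, by rw [MulAction.mem_stabilizer_iff.1 hg]; exact hs⟩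

theorem isCompact_stabilizer (hproper : IsProperAction G M) (m : M) :
    IsCompact (MulAction.stabilizer G m : Set G) := by
  have h := (hproper.2 {(m, m)} isCompact_singleton).image continuous_fst
  convert h using 1
  ext g
  constructor
  · intro hg
    refine ⟨(g, m), ?_, rfl⟩
    exact Prod.ext hg rfl
  · rintro ⟨⟨g', x⟩, hg, rfl⟩
    have h1 : g' • x = m := congrArg Prod.fst hg
    have h2 : x = m := congrArg Prod.snd hg
    subst h2
    exact h1

/-- The points of a slice at `m` that have the orbit type of `m` have the stabilizer of `m`. -/
theorem IsSlice.stabilizer_eq [T2Space G] (hG : IsLieGroup 𝓖) (hproper : IsProperAction G M)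
    (h : IsSlice 𝓖 𝓜 m S) {s : M} (hs : s ∈ S) (ht : orbitType G s = orbitType G m) :
    MulAction.stabilizer G s = MulAction.stabilizer G m := by
  obtain ⟨a, ha⟩ := conjClass_eq_iff.1 ht
  obtain ⟨hH, -⟩ := h.locally_product
  have hle := h.stabilizer_le hs
  rw [ha] at hle ⊢
  exact map_conj_eq_of_le hG hH (isCompact_stabilizer hproper m) hle

theorem SliceTube.isSubconjugate {hS : 𝓜.IsSubmanifold S} (T : SliceTube G 𝓜 m hS)
    (h : IsSlice 𝓖 𝓜 m S) {x : M} (hx : x ∈ T.homeo.target) :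
    IsSubconjugate (MulAction.stabilizer G x) (MulAction.stabilizer G m) := by
  refine (IsSubconjugate.of_orbitType_eq (T.orbitType_eq hx)).trans ⟨1, ?_⟩
  rintro _ ⟨g, hg, rfl⟩
  simpa using h.stabilizer_le (T.homeo.symm x).2.2 hg

end Slices

/-! ### The manifold structure of the strata -/

section Strata

variable {G M : Type u} [Group G] [TopologicalSpace M] [MulAction G M]
  {𝓜 : SmoothAtlas M} {m : M} {S : Set M}

/-- The points of `S` that have the orbit type of `m`. -/
abbrev partialSlice (G : Type u) {M : Type u} [Group G] [MulAction G M] (m : M) (S : Set M) :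
    Set S :=
  {s : S | orbitType G (s : M) = orbitType G m}

/-- The inclusion of the partial slice into the orbit type subset. -/
def partialSlice.incl (s : partialSlice G m S) : orbitTypeSubset G M (orbitType G m) :=
  ⟨((s : S) : M), s.2⟩

namespace SliceTube

variable {hS : 𝓜.IsSubmanifold S} (T : SliceTube G 𝓜 m hS)

/-- The chart of `M` given by charts of the two factors of a tube. -/
def chart (b : LCChart T.Base) (c : LCChart S) : LCChart M := (b.prod c).transport T.homeo

theorem isChart_chart {b : LCChart T.Base} {c : LCChart S} (hb : T.atlas.IsChart b)
    (hc : hS.atlas.IsChart c) : 𝓜.IsChart (T.chart b c) :=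
  (hb.prod hc).transport T.isDiffeo

theorem mem_chart_source {b : LCChart T.Base} {c : LCChart S} {x : M} :
    x ∈ (T.chart b c).homeo.source ↔ x ∈ T.homeo.target ∧
      (T.homeo.symm x).1 ∈ b.homeo.source ∧ (T.homeo.symm x).2 ∈ c.homeo.source :=
  Iff.rfl

theorem isAdapted_chart (b : LCChart T.Base) {c : LCChart S} {F : Submodule ℝ c.Model}
    (hF : c.IsAdapted (partialSlice G m S) F) :
    (T.chart b c).IsAdapted (orbitTypeSubset G M (orbitType G m))
      (Submodule.prod (⊤ : Submodule ℝ b.Model) F) := by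
  refine ⟨?_, fun x hx => ?_⟩
  · exact isClosed_univ.prod hF.isClosed
  · have hx' := T.mem_chart_source.1 hx
    have h1 : x ∈ orbitTypeSubset G M (orbitType G m) ↔
        (T.homeo.symm x).2 ∈ partialSlice G m S := by
      change orbitType G x = _ ↔ orbitType G _ = _
      rw [T.orbitType_eq hx'.1]
    rw [h1, hF.mem_iff _ hx'.2.2]
    exact ⟨fun h => ⟨trivial, h⟩, fun h => h.2⟩

open Classical in
/-- The projection of the orbit type subset to the partial slice along a tube. -/
noncomputable def retract (s₀ : partialSlice G m S)
    (x : orbitTypeSubset G M (orbitType G m)) : partialSlice G m S :=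
  if hx : (x : M) ∈ T.homeo.target then
    ⟨(T.homeo.symm x).2, (T.orbitType_eq hx).symm.trans x.2⟩ else s₀

theorem coe_retract (s₀ : partialSlice G m S) {x : orbitTypeSubset G M (orbitType G m)}
    (hx : (x : M) ∈ T.homeo.target) : (T.retract s₀ x : S) = (T.homeo.symm x).2 :=
  congrArg Subtype.val (dif_pos hx)

theorem retract_incl (s₀ : partialSlice G m S) {s : partialSlice G m S}
    (hs : MulAction.stabilizer G ((s : S) : M) = MulAction.stabilizer G m) :
    T.retract s₀ (partialSlice.incl s) = s :=
  Subtype.ext ((T.coe_retract s₀ (T.mem_target hs)).trans (congrArg Prod.snd (T.symm_apply hs)))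

theorem pieceProj_incl_retract (s₀ : partialSlice G m S)
    {x : orbitTypeSubset G M (orbitType G m)} (hx : (x : M) ∈ T.homeo.target) :
    pieceProj G M (orbitType G m) (partialSlice.incl (T.retract s₀ x)) =
      pieceProj G M (orbitType G m) x := by
  obtain ⟨g, hg⟩ := T.eq_smul hx
  refine (pieceProj_smul g ?_).symm
  change (x : M) = g • ((T.retract s₀ x : S) : M)
  rw [T.coe_retract s₀ hx]
  exact hg

theorem smoothOn_retract (hN : 𝓜.IsSubmanifold (orbitTypeSubset G M (orbitType G m)))
    (hP : hS.atlas.IsSubmanifold (partialSlice G m S)) (s₀ : partialSlice G m S) :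
    hN.atlas.SmoothOn hP.atlas (T.retract s₀) (Subtype.val ⁻¹' T.homeo.target) := by
  have hopen : IsOpen
      (Subtype.val ⁻¹' T.homeo.target : Set (orbitTypeSubset G M (orbitType G m))) :=
    T.homeo.open_target.preimage continuous_subtype_val
  refine hP.smoothOn_of_val hopen ?_
  have h1 : hN.atlas.SmoothOn (T.atlas.prod hS.atlas) (fun x => T.homeo.symm (x : M))
      (Subtype.val ⁻¹' T.homeo.target) :=
    SmoothAtlas.SmoothOn.comp T.isDiffeo.2 (hN.smooth_val.smoothOn _) hopen T.homeo.open_target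
      fun x hx => hx
  exact ((SmoothAtlas.smooth_snd T.atlas hS.atlas).comp_smoothOn h1 hopen).congr hopen
    fun x hx => T.coe_retract s₀ hx

end SliceTube

theorem smooth_incl {hS : 𝓜.IsSubmanifold S}
    (hN : 𝓜.IsSubmanifold (orbitTypeSubset G M (orbitType G m)))
    (hP : hS.atlas.IsSubmanifold (partialSlice G m S)) :
    hP.atlas.Smooth hN.atlas partialSlice.incl :=
  hN.smoothOn_of_val isOpen_univ (SmoothAtlas.Smooth.comp (g := (Subtype.val : S → M))
    (f := (Subtype.val : partialSlice G m S → S)) hS.smooth_val hP.smooth_val)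

theorem smooth_smul_orbitTypeSubset {τ : Set (Subgroup G)}
    (hN : 𝓜.IsSubmanifold (orbitTypeSubset G M τ))
    {g : G} (hg : 𝓜.Smooth 𝓜 fun x => g • x) :
    hN.atlas.Smooth hN.atlas
      (fun x => (⟨g • (x : M), (orbitType_smul g (x : M)).trans x.2⟩ : orbitTypeSubset G M τ)) :=
  hN.smoothOn_of_val isOpen_univ (SmoothAtlas.Smooth.comp (g := fun x : M => g • x)
    (f := (Subtype.val : orbitTypeSubset G M τ → M)) hg hN.smooth_val)

variable [TopologicalSpace G] {𝓖 : SmoothAtlas G}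

theorem isSubmanifold_orbitTypeSubset (hslice : ∀ m : M, ∃ S : Set M, IsSlice 𝓖 𝓜 m S)
    (τ : Set (Subgroup G)) :
    𝓜.IsSubmanifold (orbitTypeSubset G M τ) := by
  intro m hm
  have hm : orbitType G m = τ := hm
  subst hm
  obtain ⟨S, h⟩ := hslice m
  obtain ⟨T⟩ := h.nonempty_tube
  obtain ⟨c, hc, hmc, F, hF⟩ := h.partial_submanifold ⟨m, h.mem⟩ rfl
  obtain ⟨b, hb, hbc⟩ := T.atlas.cover T.center
  refine ⟨T.chart b c, T.isChart_chart (SmoothAtlas.isChart_of_mem hb) hc, ?_,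
    _, T.isAdapted_chart b hF⟩
  have := T.symm_apply (s := ⟨m, h.mem⟩) rfl
  refine T.mem_chart_source.2 ⟨T.mem_target (s := ⟨m, h.mem⟩) rfl, ?_, ?_⟩
  · rw [this]; exact hbc
  · rw [this]; exact hmc

/-- The partial slice is an open part of the stratum of the orbit space. -/
theorem isOpenEmbedding_pieceProj_incl [ContinuousConstSMul G M] (h : IsSlice 𝓖 𝓜 m S)
    (hN : 𝓜.IsSubmanifold (orbitTypeSubset G M (orbitType G m)))
    (hst : ∀ s ∈ S, orbitType G s = orbitType G m →
      MulAction.stabilizer G s = MulAction.stabilizer G m) :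
    IsOpenEmbedding fun s : partialSlice G m S =>
      pieceProj G M (orbitType G m) (partialSlice.incl s) := by
  obtain ⟨T⟩ := h.nonempty_tube
  let s₀ : partialSlice G m S := ⟨⟨m, h.mem⟩, rfl⟩
  refine IsOpenEmbedding.of_continuous_injective_isOpenMap ?_ ?_ ?_
  · exact (continuous_pieceProj _).comp (smooth_incl hN h.partial_submanifold).continuous
  · intro s t hst'
    obtain ⟨g, hg⟩ := exists_smul_of_pieceProj_eq hst'
    have hg : g • ((s : S) : M) = ((t : S) : M) := hg
    have hgm := h.mem_stabilizer g ⟨_, (s : S).2, by rw [hg]; exact (t : S).2⟩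
    rw [← hst _ (s : S).2 s.2, MulAction.mem_stabilizer_iff, hg] at hgm
    exact Subtype.ext (Subtype.ext hgm.symm)
  · intro O hO
    have hopen : IsOpen
        (Subtype.val ⁻¹' T.homeo.target : Set (orbitTypeSubset G M (orbitType G m))) :=
      T.homeo.open_target.preimage continuous_subtype_val
    have h1 := (T.smoothOn_retract hN h.partial_submanifold s₀).isOpen_inter_preimage hopen hO
    convert isOpenMap_pieceProj (G := G) (orbitType G m) _ h1 using 1
    ext y
    constructor
    · rintro ⟨s, hs, rfl⟩
      have hs' := hst _ (s : S).2 s.2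
      have ht : ((partialSlice.incl s : orbitTypeSubset G M (orbitType G m)) : M) ∈
          T.homeo.target := T.mem_target hs'
      refine ⟨partialSlice.incl s, ⟨ht, ?_⟩, rfl⟩
      rw [mem_preimage, T.retract_incl s₀ hs']
      exact hs
    · rintro ⟨x, ⟨hx, hxO⟩, rfl⟩
      exact ⟨T.retract s₀ x, hxO, T.pieceProj_incl_retract s₀ hx⟩

/-- Around each point of an orbit type subset there are charts in which the projection to the
orbit space is linear. -/
theorem exists_quotientChart [ContinuousConstSMul G M] (h : IsSlice 𝓖 𝓜 m S)
    (hsmul : ∀ g : G, 𝓜.Smooth 𝓜 fun x => g • x)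
    (hN : 𝓜.IsSubmanifold (orbitTypeSubset G M (orbitType G m)))
    (hst : ∀ s ∈ S, orbitType G s = orbitType G m →
      MulAction.stabilizer G s = MulAction.stabilizer G m) :
    ∃ (e : LCChart (orbitTypeSubset G M (orbitType G m)))
      (d : LCChart (orbitSpacePiece G M (orbitType G m))), hN.atlas.IsChart e ∧
      hN.atlas.IsQuotientChart (pieceProj G M (orbitType G m)) d ∧ ⟨m, rfl⟩ ∈ e.homeo.source ∧
      MapsTo (pieceProj G M (orbitType G m)) e.homeo.source d.homeo.source ∧
      ∃ (p : e.Model →L[ℝ] d.Model) (s : d.Model →L[ℝ] e.Model), (∀ z, p (s z) = z) ∧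
        ∀ y ∈ e.homeo.source, d.homeo (pieceProj G M (orbitType G m) y) = p (e.homeo y) := by
  obtain ⟨T⟩ := h.nonempty_tube
  have hP := h.partial_submanifold
  let s₀ : partialSlice G m S := ⟨⟨m, h.mem⟩, rfl⟩
  have hj := isOpenEmbedding_pieceProj_incl h hN hst
  have : Nonempty (partialSlice G m S) := ⟨s₀⟩
  let j := hj.toOpenPartialHomeomorph
  have hjl : ∀ s, j.symm (pieceProj G M (orbitType G m) (partialSlice.incl s)) = s :=
    fun s => j.left_inv (mem_univ s)
  have hjt : ∀ s, pieceProj G M (orbitType G m) (partialSlice.incl s) ∈ j.target :=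
    fun s => j.map_source (mem_univ s)
  obtain ⟨c, hc, hmc, F, hF⟩ := hP ⟨m, h.mem⟩ rfl
  obtain ⟨b, hb, hbc⟩ := T.atlas.cover T.center
  have hcF : hP.atlas.IsChart (c.restrict hF s₀) := SmoothAtlas.isChart_restrict hP hc hF s₀
  have hA := T.isAdapted_chart b hF
  have hE := T.isChart_chart (SmoothAtlas.isChart_of_mem hb) hc
  let d : LCChart (orbitSpacePiece G M (orbitType G m)) := (c.restrict hF s₀).transport j
  have hd : ∀ s, pieceProj G M (orbitType G m) (partialSlice.incl s) ∈ d.homeo.source ↔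
      s ∈ (c.restrict hF s₀).homeo.source := by
    intro s
    refine ⟨fun hs => ?_, fun hs => ⟨hjt s, ?_⟩⟩
    · have h2 : j.symm _ ∈ (c.restrict hF s₀).homeo.source := hs.2
      rwa [hjl] at h2
    · change j.symm _ ∈ (c.restrict hF s₀).homeo.source
      rwa [hjl]
  have hdapply : ∀ s, d.homeo (pieceProj G M (orbitType G m) (partialSlice.incl s)) =
      (c.restrict hF s₀).homeo s := by
    intro s
    change (c.restrict hF s₀).homeo (j.symm _) = _
    rw [hjl]
  have hx₀ : (m : M) ∈ (T.chart b c).homeo.source := by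
    have := T.symm_apply (s := ⟨m, h.mem⟩) rfl
    refine T.mem_chart_source.2 ⟨T.mem_target (s := ⟨m, h.mem⟩) rfl, ?_, ?_⟩
    · rw [this]; exact hbc
    · rw [this]; exact hmc
  refine ⟨(T.chart b c).restrict hA ⟨m, rfl⟩, d, SmoothAtlas.isChart_restrict hN hE hA _,
    ⟨?_, ?_⟩, hx₀, ?_, ?_⟩
  · refine SmoothAtlas.SmoothOn.of_local
      (d.homeo.open_source.preimage (continuous_pieceProj _)) fun x hx => ?_
    have hxj : pieceProj G M (orbitType G m) x ∈ j.target := hx.1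
    rw [hj.toOpenPartialHomeomorph_target] at hxj
    obtain ⟨s, hsx⟩ := hxj
    have hsx : pieceProj G M (orbitType G m) (partialSlice.incl s) = pieceProj G M _ x := hsx
    rw [mem_preimage, ← hsx] at hx
    have hs := (hd s).1 hx
    have hs' := hst _ (s : S).2 s.2
    obtain ⟨g, hg⟩ := exists_smul_of_pieceProj_eq hsx.symm
    let k : orbitTypeSubset G M (orbitType G m) → orbitTypeSubset G M (orbitType G m) :=
      fun y => ⟨g • (y : M), (orbitType_smul g (y : M)).trans y.2⟩
    have hk : hN.atlas.Smooth hN.atlas k := smooth_smul_orbitTypeSubset hN (hsmul g)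
    have hkx : k x = partialSlice.incl s := Subtype.ext hg
    have hO : IsOpen (Subtype.val ⁻¹' T.homeo.target :
        Set (orbitTypeSubset G M (orbitType G m))) :=
      T.homeo.open_target.preimage continuous_subtype_val
    have hW := hO.preimage hk.continuous
    have hr : hN.atlas.SmoothOn hP.atlas (fun y => T.retract s₀ (k y))
        (k ⁻¹' (Subtype.val ⁻¹' T.homeo.target)) :=
      SmoothAtlas.SmoothOn.comp (T.smoothOn_retract hN hP s₀) (hk.smoothOn _) hW hO
        fun y hy => hy
    have hW' := hr.isOpen_inter_preimage hW (c.restrict hF s₀).homeo.open_source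
    refine ⟨_, hW', ⟨?_, ?_⟩, ?_⟩
    · rw [mem_preimage, hkx]
      exact T.mem_target hs'
    · rw [mem_preimage, hkx, T.retract_incl s₀ hs']
      exact hs
    · refine (SmoothAtlas.SmoothOn.comp hcF.smoothOn (hr.mono inter_subset_left) hW'
        (c.restrict hF s₀).homeo.open_source fun y hy => hy.2).congr hW' fun y hy => ?_
      have h1 : pieceProj G M (orbitType G m) y = pieceProj G M (orbitType G m)
          (partialSlice.incl (T.retract s₀ (k y))) :=
        ((T.pieceProj_incl_retract s₀ hy.1).trans (pieceProj_smul g rfl)).symm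
      simp only [h1]
      exact hdapply _
  · intro y hy
    refine ⟨d.homeo.target, fun z => partialSlice.incl ((c.restrict hF s₀).homeo.symm z),
      d.homeo.open_target, d.homeo.map_source hy, subset_rfl, ?_, fun z hz => rfl⟩
    exact (smooth_incl hN hP).comp_smoothOn (hcF.smoothOn_symm.mono fun z hz => hz.1)
      d.homeo.open_target
  · intro y hy
    have hy' := T.mem_chart_source.1 (show (y : M) ∈ (T.chart b c).homeo.source from hy)
    rw [← T.pieceProj_incl_retract s₀ hy'.1, hd]
    change (T.retract s₀ y : S) ∈ c.homeo.source
    rw [T.coe_retract s₀ hy'.1]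
    exact hy'.2.2
  · let F' : Submodule ℝ (b.Model × c.Model) := Submodule.prod ⊤ F
    let p : F' →L[ℝ] F := ((ContinuousLinearMap.snd ℝ b.Model c.Model).comp
      F'.subtypeL).codRestrict F fun z => z.2.2
    let s : F →L[ℝ] F' := ((ContinuousLinearMap.inr ℝ b.Model c.Model).comp
      F.subtypeL).codRestrict F' fun z => ⟨trivial, z.2⟩
    refine ⟨p, s, fun z => rfl, fun y hy => ?_⟩
    have hy' := T.mem_chart_source.1 (show (y : M) ∈ (T.chart b c).homeo.source from hy)
    rw [← T.pieceProj_incl_retract s₀ hy'.1, hdapply]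
    have hret := T.coe_retract s₀ hy'.1
    refine Subtype.ext ((hF.restrict_apply s₀ (x := T.retract s₀ y) ?_).trans ?_)
    · rw [hret]
      exact hy'.2.2
    · rw [hret]
      exact congrArg Prod.snd (hA.restrict_apply ⟨m, rfl⟩ (x := y) hy).symm

end Strata

/-! ### The orbit type stratification -/

theorem smooth_smul_left {G M : Type u} [Group G] [TopologicalSpace G] [TopologicalSpace M]
    [MulAction G M] {𝓖 : SmoothAtlas G} {𝓜 : SmoothAtlas M}
    (hsmooth : (𝓖.prod 𝓜).Smooth 𝓜 fun p => p.1 • p.2) (g : G) :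
    𝓜.Smooth 𝓜 fun x => g • x :=
  SmoothAtlas.Smooth.comp (g := fun p : G × M => p.1 • p.2) (f := fun x => (g, x)) hsmooth
    (SmoothAtlas.SmoothOn.prodMk (SmoothAtlas.smooth_const 𝓜 𝓖 g) 𝓜.smooth_id)

theorem isOpen_image_mk {G M : Type u} [Group G] [TopologicalSpace M] [MulAction G M]
    [ContinuousConstSMul G M] {V : Set M} (hV : IsOpen V) :
    IsOpen (Quotient.mk (MulAction.orbitRel G M) '' V) :=
  isOpenMap_quotient_mk'_mul (Γ := G) (T := M) V hV

theorem orbitTypeSubset_subset_closure {G M : Type u} [Group G] [TopologicalSpace M]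
    [MulAction G M]
    (happrox : ∀ H : Subgroup G, (∃ m : M, MulAction.stabilizer G m = H) →
      orbitTypeAbove M H ⊆ closure (orbitTypeSubset G M (conjClass H)))
    {m n : M} (h : IsSubconjugate (MulAction.stabilizer G n) (MulAction.stabilizer G m)) :
    orbitTypeSubset G M (orbitType G m) ⊆ closure (orbitTypeSubset G M (orbitType G n)) :=
  fun x hx => happrox _ ⟨n, rfl⟩ (h.trans (IsSubconjugate.of_orbitType_eq
    (show orbitType G m = orbitType G x from hx.symm)))

section Pieces

variable {G M : Type u} [Group G] [TopologicalSpace G] [TopologicalSpace M] [MulAction G M]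
  {𝓖 : SmoothAtlas G} {𝓜 : SmoothAtlas M}

theorem isLocallyClosed_orbitSpacePiece [ContinuousConstSMul G M]
    (hslice : ∀ m : M, ∃ S : Set M, IsSlice 𝓖 𝓜 m S) (τ : Set (Subgroup G)) :
    IsLocallyClosed (orbitSpacePiece G M τ) := by
  refine ⟨(closure (orbitSpacePiece G M τ) \ orbitSpacePiece G M τ)ᶜ,
    closure (orbitSpacePiece G M τ), ?_, isClosed_closure, ?_⟩
  · rw [isOpen_iff_mem_nhds]
    intro y hy
    by_cases hyτ : y ∈ orbitSpacePiece G M τ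
    · obtain ⟨m, hm, rfl⟩ := hyτ
      have hm : orbitType G m = τ := hm
      subst hm
      obtain ⟨S, h⟩ := hslice m
      obtain ⟨T⟩ := h.nonempty_tube
      have hmT : m ∈ T.homeo.target := T.mem_target (s := ⟨m, h.mem⟩) rfl
      filter_upwards [(isOpen_image_mk (G := G) T.homeo.open_target).mem_nhds
        (mem_image_of_mem _ hmT)]
      rintro _ ⟨x, hx, rfl⟩ ⟨hcl, hnot⟩
      rw [mk_mem_closure_orbitSpacePiece] at hcl
      exact hnot (mk_mem_orbitSpacePiece.2 (T.mem_of_mem_closure h.partial_isClosed hx hcl))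
    · have hcl : y ∉ closure (orbitSpacePiece G M τ) := fun hcl => hy ⟨hcl, hyτ⟩
      filter_upwards [isClosed_closure.isOpen_compl.mem_nhds hcl] with z hz hz'
      exact hz hz'.1
  · ext y
    constructor
    · exact fun hy => ⟨fun h => h.2 hy, subset_closure hy⟩
    · rintro ⟨h1, h2⟩
      by_contra h3
      exact h1 ⟨h2, h3⟩

/-- If points of another orbit type accumulate at `m`, then the stabilizers of points of that type
are conjugate to subgroups of the stabilizer of `m`. -/
theorem isSubconjugate_of_mem_closure (hslice : ∀ m : M, ∃ S : Set M, IsSlice 𝓖 𝓜 m S)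
    {m n : M} (hm : m ∈ closure (orbitTypeSubset G M (orbitType G n))) :
    IsSubconjugate (MulAction.stabilizer G n) (MulAction.stabilizer G m) := by
  obtain ⟨S, h⟩ := hslice m
  obtain ⟨T⟩ := h.nonempty_tube
  obtain ⟨x, hx, hxn⟩ := mem_closure_iff.1 hm _ T.homeo.open_target
    (T.mem_target (s := ⟨m, h.mem⟩) rfl)
  have hxn : orbitType G x = orbitType G n := hxn
  exact (IsSubconjugate.of_orbitType_eq hxn.symm).trans (T.isSubconjugate h hx)

/-- Two orbit types that accumulate at each other are equal. -/
theorem orbitType_eq_of_mem_closure (hslice : ∀ m : M, ∃ S : Set M, IsSlice 𝓖 𝓜 m S)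
    (happrox : ∀ H : Subgroup G, (∃ m : M, MulAction.stabilizer G m = H) →
      orbitTypeAbove M H ⊆ closure (orbitTypeSubset G M (conjClass H)))
    {m n : M} (hm : m ∈ closure (orbitTypeSubset G M (orbitType G n)))
    (h : IsSubconjugate (MulAction.stabilizer G m) (MulAction.stabilizer G n)) :
    orbitType G n = orbitType G m := by
  obtain ⟨S, hS⟩ := hslice m
  obtain ⟨T⟩ := hS.nonempty_tube
  obtain ⟨x, hx, hxn⟩ := mem_closure_iff.1 hm _ T.homeo.open_target
    (T.mem_target (s := ⟨m, hS.mem⟩) rfl)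
  have hxn : orbitType G x = orbitType G n := hxn
  have hcl := orbitTypeSubset_subset_closure happrox h hxn
  exact hxn.symm.trans (T.mem_of_mem_closure hS.partial_isClosed hx hcl)

end Pieces

theorem mainTheorem6 {G M : Type u} [Group G] [TopologicalSpace G] [T2Space G]
    [TopologicalSpace M] [T2Space M] [MulAction G M]
    (𝓖 : SmoothAtlas G) (hG : IsLieGroup 𝓖) (𝓜 : SmoothAtlas M)
    (hsmooth : (𝓖.prod 𝓜).Smooth 𝓜 fun p => p.1 • p.2)
    (hproper : IsProperAction G M)
    (hgen : CompactlyGeneratedSpace (M × M))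
    (hslice : ∀ m : M, ∃ S : Set M, IsSlice 𝓖 𝓜 m S)
    (happrox : ∀ H : Subgroup G, (∃ m : M, MulAction.stabilizer G m = H) →
      orbitTypeAbove M H ⊆ closure (orbitTypeSubset G M (conjClass H))) :
    ∃ Z : Stratification (fun τ : OrbitTypes G M => orbitSpacePiece G M τ),
      ∀ τ : OrbitTypes G M, ∃ hτ : 𝓜.IsSubmanifold (orbitTypeSubset G M τ),
        hτ.atlas.IsSubmersion (Z.atlas τ) (pieceProj G M τ) ∧
        ∀ B : SmoothAtlas (orbitSpacePiece G M τ),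
          hτ.atlas.IsSubmersion B (pieceProj G M τ) → B.Equivalent (Z.atlas τ) := by

  have := hG.isTopologicalGroup
  have : ContinuousSMul G M := ⟨hsmooth.continuous⟩
  have : ProperSMul G M :=
    ⟨isProperMap_iff_isCompact_preimage.2 ⟨hproper.1, fun K hK => hproper.2 K hK⟩⟩
  have hst : ∀ (m : M) (S : Set M), IsSlice 𝓖 𝓜 m S → ∀ s ∈ S, orbitType G s = orbitType G m →
      MulAction.stabilizer G s = MulAction.stabilizer G m :=
    fun m S h s hs ht => h.stabilizer_eq hG hproper hs ht
  have hN := fun τ => isSubmanifold_orbitTypeSubset hslice τ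
  have hchart : ∀ (τ : Set (Subgroup G)) (x : orbitTypeSubset G M τ),
      ∃ (e : LCChart (orbitTypeSubset G M τ)) (d : LCChart (orbitSpacePiece G M τ)),
        (hN τ).atlas.IsChart e ∧ (hN τ).atlas.IsQuotientChart (pieceProj G M τ) d ∧
        x ∈ e.homeo.source ∧ MapsTo (pieceProj G M τ) e.homeo.source d.homeo.source ∧
        ∃ (p : e.Model →L[ℝ] d.Model) (s : d.Model →L[ℝ] e.Model), (∀ z, p (s z) = z) ∧
          ∀ y ∈ e.homeo.source, d.homeo (pieceProj G M τ y) = p (e.homeo y) := by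
    rintro τ ⟨m, hm⟩
    have hm' : orbitType G m = τ := hm
    subst hm'
    obtain ⟨S, h⟩ := hslice m
    exact exists_quotientChart h (smooth_smul_left hsmooth) (hN _) (hst m S h)
  have hcover : ∀ τ (y : orbitSpacePiece G M τ), ∃ d,
      (hN τ).atlas.IsQuotientChart (pieceProj G M τ) d ∧ y ∈ d.homeo.source := by
    intro τ y
    obtain ⟨x, rfl⟩ := pieceProj_surjective τ y
    obtain ⟨e, d, -, hd, hx, hmaps, -⟩ := hchart τ x
    exact ⟨d, hd, hmaps hx⟩
  have hdisj : ∀ {σ τ : Set (Subgroup G)} {y : OrbitSpace G M}, y ∈ orbitSpacePiece G M σ →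
      y ∈ orbitSpacePiece G M τ → σ = τ := by
    rintro σ τ _ ⟨x, hx, rfl⟩ hy
    exact hx.symm.trans (mk_mem_orbitSpacePiece.1 hy)
  let Z : Stratification (fun τ : OrbitTypes G M => orbitSpacePiece G M τ) :=
    { t2Space := inferInstance
      nonempty := by
        rintro ⟨_, m, rfl⟩
        exact ⟨_, mem_image_of_mem _ (show orbitType G m = orbitType G m from rfl)⟩
      pairwiseDisjoint := fun σ τ hne => disjoint_left.2 fun y hσ hτ =>
        hne (Subtype.ext (hdisj hσ hτ))
      iUnion_eq := by
        refine eq_univ_of_forall fun y => ?_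
        obtain ⟨x, rfl⟩ := Quotient.exists_rep y
        exact mem_iUnion.2 ⟨⟨orbitType G x, x, rfl⟩, mem_image_of_mem _ rfl⟩
      atlas := fun τ => (hN τ).atlas.quotientAtlas (continuous_pieceProj _) (hcover τ)
      isLocallyClosed := fun τ => isLocallyClosed_orbitSpacePiece hslice τ
      frontier_condition := by
        rintro ⟨_, m, rfl⟩ ⟨_, n, rfl⟩ hd ⟨y, hyσ, hyτ⟩
        obtain ⟨x, hx, rfl⟩ := hyσ
        have hx : orbitType G x = orbitType G m := hx
        rw [mk_mem_closure_orbitSpacePiece] at hyτ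
        have hnm : IsSubconjugate (MulAction.stabilizer G n) (MulAction.stabilizer G m) :=
          (isSubconjugate_of_mem_closure hslice hyτ).trans (IsSubconjugate.of_orbitType_eq hx)
        refine ⟨?_, ?_⟩
        · rintro _ ⟨z, hz, rfl⟩
          refine ⟨mk_mem_closure_orbitSpacePiece.2
            (orbitTypeSubset_subset_closure happrox hnm hz), ?_⟩
          exact disjoint_left.1 hd (mem_image_of_mem _ hz)
        · refine disjoint_left.2 ?_
          rintro _ ⟨z, hz, rfl⟩ hcl
          rw [mk_mem_closure_orbitSpacePiece] at hcl
          have hz : orbitType G z = orbitType G n := hz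
          have he := orbitType_eq_of_mem_closure hslice happrox hcl
            ((IsSubconjugate.of_orbitType_eq hz).trans hnm)
          refine disjoint_left.1 hd (mem_image_of_mem _ hx) (mem_image_of_mem _ ?_)
          exact hx.trans (he.trans hz) }
  refine ⟨Z, fun τ => ⟨hN τ, ⟨SmoothAtlas.smooth_quotientAtlas (continuous_pieceProj _) (hcover τ),
    fun x => ?_⟩, fun B hB => hB.equivalent_quotientAtlas (pieceProj_surjective _) (continuous_pieceProj _) (hcover τ)⟩⟩
  obtain ⟨e, d, he, hd, hx, hmaps, hlin⟩ := hchart τ x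
  exact ⟨e, d, he, SmoothAtlas.isChart_of_mem hd, hx, hmaps, hlin⟩
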